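/- Let $\mathbb P_d$ be the set of real symmetric positive definite $d\times d$ matrices, with the Frobenius inner product $\langle A,B\rangle=\operatorname{tr}(A^\top B)$, the affine-invariant distance $\delta_R(A,B)=\|\log(A^{-1/2}BA^{-1/2})\|_F$ and the geodesics $\gamma_{A,B}(t)=A^{1/2}(A^{-1/2}BA^{-1/2})^tA^{1/2}$, $0\le t\le 1$. A function $\phi:\mathbb P_d\to\mathbb R$ is \emph{g-convex} if $\phi\circ\gamma_{A,B}$ is convex on $[0,1]$ for all $A,B\in\mathbb P_d$. It is \emph{DC} with decomposition $(f,h)$ if $\phi=f-h$ on $\mathbb P_d$ with $f,h$ convex in the Euclidean sense and $h$ differentiable with locally Lipschitz Euclidean gradient $\nabla h$ (for example $h\in C^2$). The \emph{convex-concave procedure} (CCCP) for $(f,h)$ started at $X_0\in\mathbb P_d$ chooses $$X_{k+1}\in\operatorname*{arg\,min}_{X\in\mathbb P_d}Q(X,X_k),\qquad Q(X,Y)=f(X)-h(Y)-\langle\nabla h(Y),X-Y\rangle .$$ \textbf{(1)} For every $d$ there is a function $\alpha:\mathbb P_d\times\mathbb R\to\mathbb R$ such that the following holds. Let $\hat\phi=\phi+\mathcal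 R$ be a regularized objective on $\mathbb P_d$ that is g-convex and DC with decomposition $(f,h)$, and let $X_0\in\mathbb P_d$ be such that the sublevel set $\mathcal S=\{X\in\mathbb P_d:\hat\phi(X)\le\hat\phi(X_0)\}$ is $\delta_R$-bounded. Then $\hat\phi$ has a global minimizer on $\mathbb P_d$; CCCP iterates from $X_0$ exist; and $\nabla h$ is Lipschitz on the (Euclidean) convex hull of $\mathcal S$. Moreover, for every sequence $(X_k)$ of CCCP iterates from $X_0$: (a) if $X^*$ is a global minimizer of $\hat\phi$, $\delta_R(X,X^*)\le R$ for all $X\in\mathcal S$, and $L\ge0$ is a Lipschitz constant (in the Frobenius norm) of $\nabla h$ on the convex hull of $\mathcal S$, then $$\hat\phi(X_k)-\hat\phi(X^*)\le\frac{2L\,\alpha(X^*,R)^2}{k+2}\qquad\text{for all }k\ge1;$$ (b) the $\delta_R$-distance of $X_k$ to the set of global minimizers of $\hat\phi$ tends to $0$ as $k\to\infty$. \textbf{(2)} Let $S$ be a symmetric positive semidefinite $d\times d$ matrix (such as a sample covariance matrix), $\hat\Sigma,\Sigma_0\in\mathbb P_d$ and $\beta>0$, and suppose that $S\succ0$ or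 $\beta>2$. Let $$\hat\phi(\Sigma)=\operatorname{tr}(S\Sigma^{-1})+\log\det\Sigma+\beta\,\delta_S^2(\Sigma,\hat\Sigma),\qquad \delta_S^2(X,Y)=\log\det\tfrac{X+Y}2-\tfrac12\log\det(XY).$$ Then $\hat\phi$ has a unique minimizer $\Sigma^*$ on $\mathbb P_d$, and: (a) CCCP for the decomposition $f(\Sigma)=\operatorname{tr}(S\Sigma^{-1})-\frac\beta2\log\det(\Sigma\hat\Sigma)$, $h(\Sigma)=-\log\det\Sigma-\beta\log\det\frac{\Sigma+\hat\Sigma}2$ has iterates from $\Sigma_0$, and every such sequence of iterates $\Sigma_k$ converges to $\Sigma^*$ and satisfies $\hat\phi(\Sigma_k)-\hat\phi(\Sigma^*)\le C/(k+2)$ for all $k\ge1$, with $C$ independent of $k$; (b) there is $\bar\eta>0$ such that for every number $L\ge1$ of inner steps and all step sizes $0<\eta_\ell\le\bar\eta$, the iterates defined by $\Sigma_{k,0}=\Sigma_k$, $$\Sigma_{k,\ell+1}=\Sigma_{k,\ell}-\eta_\ell\Big(-\Sigma_{k,\ell}^{-1}S\Sigma_{k,\ell}^{-1}-\tfrac\beta2\Sigma_{k,\ell}^{-1}+\Sigma_k^{-1}+\beta(\Sigma_k+\hat\Sigma)^{-1}\Big)\quad(0\le\ell<L),\qquad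 \Sigma_{k+1}=\Sigma_{k,L},$$ all lie in $\mathbb P_d$, and $\Sigma_{k,\ell}\to\Sigma^*$ as $k\to\infty$ for each $\ell\in\{0,\dots,L\}$; in particular $\Sigma_k\to\Sigma^*$. -/

import Mathlib

open Filter Topology

noncomputable section

namespace SPDCone

/-- Real `d × d` matrices. -/
abbrev Mat (d : ℕ) := Matrix (Fin d) (Fin d) ℝ

/-- The cone of symmetric positive definite matrices. -/
def PD (d : ℕ) : Set (Mat d) := {X | X.PosDef}

/-! ### Geometry of the cone -/

/-- The Frobenius inner product `tr (Aᵀ B)`. -/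
def frobInner {d : ℕ} (A B : Mat d) : ℝ := (A.transpose * B).trace

/-- The Frobenius norm. -/
def frobNorm {d : ℕ} (A : Mat d) : ℝ := Real.sqrt (frobInner A A)

/-- Real power of a symmetric positive definite matrix, by the spectral functional calculus. -/
def mpow {d : ℕ} (A : Mat d) (t : ℝ) : Mat d := cfc (fun x : ℝ => x ^ t) A

/-- Logarithm of a symmetric positive definite matrix, by the spectral functional calculus. -/
def mlog {d : ℕ} (A : Mat d) : Mat d := cfc Real.log A

/-- The affine-invariant geodesic
`γ(t) = A^{1/2} (A^{-1/2} B A^{-1/2})^t A^{1/2}` from `A` to `B`. -/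
def geodesic {d : ℕ} (A B : Mat d) (t : ℝ) : Mat d :=
  mpow A (1 / 2) * mpow (mpow A (-(1 / 2)) * B * mpow A (-(1 / 2))) t * mpow A (1 / 2)

/-- The affine-invariant Riemannian distance `‖log (A^{-1/2} B A^{-1/2})‖_F`. -/
def riemDist {d : ℕ} (A B : Mat d) : ℝ :=
  frobNorm (mlog (mpow A (-(1 / 2)) * B * mpow A (-(1 / 2))))

/-- Geodesic convexity of a real function on the positive definite cone. -/
def GConvex {d : ℕ} (φ : Mat d → ℝ) : Prop :=
  ∀ A ∈ PD d, ∀ B ∈ PD d, ConvexOn ℝ (Set.Icc (0 : ℝ) 1) (fun t => φ (geodesic A B t))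

/-! ### Euclidean gradients -/

/-- `G` is the Euclidean (Frobenius) gradient at `X` of the function `h` on the positive definite
cone, an open subset of the space of symmetric matrices: `G` is symmetric and
`h(Y) = h(X) + ⟨G, Y - X⟩ + o(‖Y - X‖)`. -/
def IsEuclGradAt {d : ℕ} (h : Mat d → ℝ) (G X : Mat d) : Prop :=
  G.IsSymm ∧
    (fun Y => h Y - h X - frobInner G (Y - X)) =o[𝓝[PD d] X] (fun Y => frobNorm (Y - X))

open Classical in
/-- The Euclidean gradient (zero where `h` is not differentiable). -/
def euclGrad {d : ℕ} (h : Mat d → ℝ) (X : Mat d) : Mat d :=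
  if H : ∃ G, IsEuclGradAt h G X then H.choose else 0

/-- The gradient of `h` is Lipschitz with constant `L` on `s`, in the Frobenius norm. -/
def LipschitzGradOn {d : ℕ} (h : Mat d → ℝ) (L : ℝ) (s : Set (Mat d)) : Prop :=
  ∀ X ∈ s, ∀ Y ∈ s, frobNorm (euclGrad h X - euclGrad h Y) ≤ L * frobNorm (X - Y)

/-- `h` is differentiable on the positive definite cone with locally Lipschitz gradient
(every `C²` function is of this kind). -/
def SmoothOnPD {d : ℕ} (h : Mat d → ℝ) : Prop :=
  (∀ X ∈ PD d, ∃ G, IsEuclGradAt h G X) ∧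
    ∀ X ∈ PD d, ∃ r > 0, ∃ L : ℝ, LipschitzGradOn h L {Y ∈ PD d | frobNorm (Y - X) < r}

/-! ### Difference-of-convex structure and the convex-concave procedure -/

/-- The regularized objective `φ + R`. -/
def regularized {d : ℕ} (φ Reg : Mat d → ℝ) (X : Mat d) : ℝ := φ X + Reg X

/-- On the positive definite cone, `φ = f - h` with `f`, `h` Euclidean convex and `h` smooth. -/
structure IsDC {d : ℕ} (φ f h : Mat d → ℝ) : Prop where
  convex_f : ConvexOn ℝ (PD d) f
  convex_h : ConvexOn ℝ (PD d) h
  smooth_h : SmoothOnPD h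
  eq_sub : ∀ X ∈ PD d, φ X = f X - h X

/-- The surrogate `Q(X, Y) = f(X) - h(Y) - ⟨∇h(Y), X - Y⟩`. -/
def surrogate {d : ℕ} (f h : Mat d → ℝ) (X Y : Mat d) : ℝ :=
  f X - h Y - frobInner (euclGrad h Y) (X - Y)

/-- `X` minimizes `φ` over the positive definite cone. -/
def IsMinimizer {d : ℕ} (φ : Mat d → ℝ) (X : Mat d) : Prop :=
  X ∈ PD d ∧ ∀ Y ∈ PD d, φ X ≤ φ Y

/-- `X` is a sequence of iterates of the convex-concave procedure started at `X₀`: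
`X (k+1)` minimizes `Q(·, X k)` over the positive definite cone. -/
def IsCCCP {d : ℕ} (f h : Mat d → ℝ) (X₀ : Mat d) (X : ℕ → Mat d) : Prop :=
  X 0 = X₀ ∧ ∀ k, IsMinimizer (fun Y => surrogate f h Y (X k)) (X (k + 1))

/-- The sublevel set of `φ` through `X₀`. -/
def sublevel {d : ℕ} (φ : Mat d → ℝ) (X₀ : Mat d) : Set (Mat d) := {X ∈ PD d | φ X ≤ φ X₀}

/-! ### The regularized Gaussian optimistic likelihood -/

/-- The S-divergence `log det ((X + Y) / 2) - (1/2) log det (X Y)`. -/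
def sDiv {d : ℕ} (X Y : Mat d) : ℝ :=
  Real.log ((1 / 2 : ℝ) • (X + Y)).det - 1 / 2 * Real.log (X * Y).det

/-- The Gaussian negative log-likelihood `tr (S X⁻¹) + log det X`. -/
def gaussNLL {d : ℕ} (S X : Mat d) : ℝ := (S * X⁻¹).trace + Real.log X.det

/-- The objective `tr (S X⁻¹) + log det X + β δ_S²(X, T)`. -/
def optLik {d : ℕ} (S T : Mat d) (β : ℝ) : Mat d → ℝ :=
  regularized (gaussNLL S) (fun X => β * sDiv X T)

/-- The convex part `f` of `optLik`. -/
def optLikF {d : ℕ} (S T : Mat d) (β : ℝ) (X : Mat d) : ℝ :=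
  (S * X⁻¹).trace - β / 2 * Real.log (X * T).det

/-- The subtracted convex part `h` of `optLik`. -/
def optLikH {d : ℕ} (T : Mat d) (β : ℝ) (X : Mat d) : ℝ :=
  -Real.log X.det - β * Real.log ((1 / 2 : ℝ) • (X + T)).det

/-- Inner loop of the algorithm: gradient steps with step sizes `η` on the surrogate at `Y`,
started at `Y`. -/
def innerIter {d : ℕ} (S T : Mat d) (β : ℝ) (η : ℕ → ℝ) (Y : Mat d) : ℕ → Mat d
  | 0 => Y
  | l + 1 =>
    let X := innerIter S T β η Y l
    X - η l • (-(X⁻¹ * S * X⁻¹) - (β / 2) • X⁻¹ + (Y⁻¹ + β • (Y + T)⁻¹))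

/-- Outer loop of the algorithm, with `L` inner gradient steps per outer iteration. -/
def outerIter {d : ℕ} (S T : Mat d) (β : ℝ) (η : ℕ → ℝ) (L : ℕ) (X₀ : Mat d) : ℕ → Mat d
  | 0 => X₀
  | k + 1 => innerIter S T β η (outerIter S T β η L X₀ k) L

end SPDCone

end

/-!
Along the geodesic from the current iterate `A` to a minimizer, the objective `φ = f - h` drops by
g-convexity, while the surrogate exceeds `φ` by at most the product of the Lipschitz constant of
`∇h` with the squared Euclidean distance to `A`, which is `O(t²)` at time `t`. Minimizing the
surrogate is thus at least as good as a Frank-Wolfe step along the geodesic, and the optimality gap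
obeys `Δ (k + 1) ≤ (1 - t) Δ k + C t²` for all `t ∈ [0, 1]`, so that `Δ k ≤ 4 C / (k + 2)`.

For the regularized likelihood, a congruence puts two given matrices and the geodesic between them
in the form `W (exp (t y)) Wᵀ`, with `exp (t y)` diagonal. Expanding `det (N + diag (exp y))` over
principal minors exhibits its logarithm as a log-sum-exp, which gives g-convexity, and strict
convexity away from `y = 0`, hence uniqueness of the minimizer. The inexact version rests on the
same geodesics: dividing by `t → 0` bounds the optimality gap by a multiple of `‖∇f - ∇h‖`, and this
residual is driven to zero by the sufficient decrease of the first inner gradient step.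
-/

noncomputable section

namespace SPDCone

open scoped Matrix Matrix.Norms.Frobenius MatrixOrder

/-! ### The Frobenius inner product and the Loewner order -/

section Frobenius

lemma frobNorm_eq_norm {d : ℕ} (A : Mat d) : frobNorm A = ‖A‖ := by
  simp only [frobNorm, frobInner, Matrix.frobenius_norm_def, Matrix.trace, Matrix.diag_apply,
    Matrix.mul_apply, Matrix.transpose_apply, ← Real.sqrt_eq_rpow, Real.norm_eq_abs,
    Real.rpow_ofNat, sq_abs, ← sq]
  rw [Finset.sum_comm]

lemma norm_sq_eq_trace {n : Type*} [Fintype n] (A : Matrix n n ℝ) : ‖A‖ ^ 2 = (Aᵀ * A).trace := by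
  rw [Matrix.frobenius_norm_def, ← Real.sqrt_eq_rpow, Real.sq_sqrt (by positivity)]
  simp only [Matrix.trace, Matrix.diag_apply, Matrix.mul_apply, Matrix.transpose_apply,
    Real.norm_eq_abs, Real.rpow_ofNat, sq_abs, ← sq]
  rw [Finset.sum_comm]

end Frobenius

section LoewnerOrder

lemma posDef_of_le {n : Type*} {A B : Matrix n n ℝ} (hA : A.PosDef) (hAB : A ≤ B) : B.PosDef := by
  simpa using hA.add_posSemidef (Matrix.le_iff.1 hAB)

lemma trace_mul_nonneg {n : Type*} [Fintype n] {A B : Matrix n n ℝ} (hA : 0 ≤ A) (hB : 0 ≤ B) :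
    0 ≤ (A * B).trace := by
  classical
  obtain ⟨C, rfl⟩ := CStarAlgebra.nonneg_iff_eq_star_mul_self.1 hA
  rw [Matrix.mul_assoc, Matrix.trace_mul_comm]
  exact ((Matrix.nonneg_iff_posSemidef.1 hB).mul_mul_conjTranspose_same C).trace_nonneg

lemma norm_le_norm_of_neg_le_of_le {n : Type*} [Fintype n] {Z B : Matrix n n ℝ} (hB : B.IsSymm)
    (hZB : -B ≤ Z) (hBZ : Z ≤ B) : ‖Z‖ ≤ ‖B‖ := by
  have hsymm : (B - Z).IsSymm := (Matrix.nonneg_iff_posSemidef.1 (sub_nonneg.2 hBZ)).isHermitian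
  have hZ : Z.IsSymm := by simpa using hB.sub hsymm
  have htrace : 0 ≤ ((B - Z) * (B + Z)).trace :=
    trace_mul_nonneg (sub_nonneg.2 hBZ) (by simpa [add_comm] using sub_nonneg.2 hZB)
  refine abs_le_of_sq_le_sq' ?_ (norm_nonneg B) |>.2
  rw [norm_sq_eq_trace, norm_sq_eq_trace, hZ.eq, hB.eq]
  simp only [Matrix.sub_mul, Matrix.mul_add, Matrix.trace_sub, Matrix.trace_add,
    Matrix.trace_mul_comm Z B] at htrace
  linarith

variable {n : Type*} [Finite n]

lemma isClosed_nonneg_matrix : IsClosed {A : Matrix n n ℝ | 0 ≤ A} := by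
  cases nonempty_fintype n
  have hset : {A : Matrix n n ℝ | 0 ≤ A} =
      {A | Aᴴ = A} ∩ ⋂ x : n → ℝ, {A | 0 ≤ star x ⬝ᵥ (A *ᵥ x)} := by
    ext A
    simp [Matrix.nonneg_iff_posSemidef, Matrix.posSemidef_iff_dotProduct_mulVec,
      Matrix.IsHermitian]
  rw [hset]
  exact (isClosed_eq (by fun_prop) continuous_id).inter <| isClosed_iInter fun x =>
    isClosed_le continuous_const (by fun_prop)

lemma isCompact_Icc_matrix (A B : Matrix n n ℝ) : IsCompact (Set.Icc A B) := by
  cases nonempty_fintype n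
  have hclosed : IsClosed (Set.Icc A B) := by
    have hset : Set.Icc A B =
        (fun X => X - A) ⁻¹' {X | 0 ≤ X} ∩ (fun X => B - X) ⁻¹' {X | 0 ≤ X} := by
      ext X
      simp
    rw [hset]
    exact (isClosed_nonneg_matrix.preimage (by fun_prop)).inter
      (isClosed_nonneg_matrix.preimage (by fun_prop))
  refine Metric.isCompact_of_isClosed_isBounded hclosed
    (Metric.isBounded_closedBall.subset fun X hX => (?_ : X ∈ Metric.closedBall A ‖B - A‖))
  have hAB : 0 ≤ B - A := sub_nonneg.2 (hX.1.trans hX.2)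
  rw [mem_closedBall_iff_norm]
  exact norm_le_norm_of_neg_le_of_le (Matrix.nonneg_iff_posSemidef.1 hAB).isHermitian
    ((neg_nonpos.2 hAB).trans (sub_nonneg.2 hX.1)) (by gcongr; exact hX.2)

end LoewnerOrder

/-! ### Congruences of diagonal matrices -/

section DiagCongr

variable {n : Type*} [Fintype n] [DecidableEq n]

/-- The congruence `W diag(v) Wᵀ` of a diagonal matrix, as a linear function of the diagonal `v`.
Simultaneous diagonalization writes two positive definite matrices, and the geodesic joining them,
in this form with a common `W`. -/
def diagCongr (W : Matrix n n ℝ) : (n → ℝ) →ₗ[ℝ] Matrix n n ℝ where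
  toFun v := W * Matrix.diagonal v * Wᵀ
  map_add' v w := by rw [← Matrix.add_mul, ← Matrix.mul_add, Matrix.diagonal_add]; rfl
  map_smul' c v := by simp

variable {W : Matrix n n ℝ} {v : n → ℝ}

lemma diagCongr_apply (W : Matrix n n ℝ) (v : n → ℝ) :
    diagCongr W v = W * Matrix.diagonal v * Wᵀ := rfl

lemma diagCongr_mul (P W : Matrix n n ℝ) (v : n → ℝ) :
    diagCongr (P * W) v = P * diagCongr W v * Pᵀ := by
  simp only [diagCongr_apply, Matrix.transpose_mul, Matrix.mul_assoc]

lemma diagCongr_one_right (W : Matrix n n ℝ) : diagCongr W 1 = W * Wᵀ := by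
  rw [diagCongr_apply, Pi.one_def, Matrix.diagonal_one, Matrix.mul_one]

lemma diagCongr_nonneg (hv : 0 ≤ v) : 0 ≤ diagCongr W v :=
  Matrix.nonneg_iff_posSemidef.2
    ((Matrix.posSemidef_diagonal_iff.2 hv).mul_mul_conjTranspose_same W)

lemma diagCongr_mono (W : Matrix n n ℝ) : Monotone (diagCongr W) := fun v w hvw => by
  simpa using diagCongr_nonneg (W := W) (sub_nonneg.2 hvw)

lemma posDef_diagCongr_iff (hW : IsUnit W) : (diagCongr W v).PosDef ↔ ∀ i, 0 < v i :=
  (Matrix.IsUnit.posDef_star_right_conjugate_iff hW).trans Matrix.posDef_diagonal_iff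

lemma det_diagCongr (W : Matrix n n ℝ) (v : n → ℝ) :
    (diagCongr W v).det = W.det ^ 2 * ∏ i, v i := by
  rw [diagCongr_apply, Matrix.det_mul, Matrix.det_mul, Matrix.det_transpose, Matrix.det_diagonal]
  ring

lemma inv_diagCongr (W : Matrix n n ℝ) (hv : ∀ i, v i ≠ 0) :
    (diagCongr W v)⁻¹ = diagCongr (W⁻¹)ᵀ v⁻¹ := by
  have hdiag : (Matrix.diagonal v)⁻¹ = Matrix.diagonal v⁻¹ :=
    Matrix.inv_eq_left_inv (by simp [Matrix.diagonal_mul_diagonal, hv])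
  rw [diagCongr_apply, Matrix.mul_inv_rev, Matrix.mul_inv_rev, hdiag, diagCongr_apply,
    Matrix.transpose_transpose, Matrix.transpose_nonsing_inv, Matrix.mul_assoc]

lemma trace_mul_diagCongr (S W : Matrix n n ℝ) (v : n → ℝ) :
    (S * diagCongr W v).trace = ∑ i, (Wᵀ * S * W) i i * v i := by
  calc (S * diagCongr W v).trace = (Wᵀ * S * W * Matrix.diagonal v).trace := by
        rw [diagCongr_apply, ← Matrix.mul_assoc, Matrix.trace_mul_comm]
        simp only [Matrix.mul_assoc]
    _ = _ := by simp only [Matrix.trace, Matrix.diag_apply, Matrix.mul_diagonal]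

lemma isUnit_of_mem_orthogonalGroup (hW : W ∈ Matrix.orthogonalGroup n ℝ) : IsUnit W :=
  IsUnit.of_mul_eq_one _ ((Matrix.mem_orthogonalGroup_iff n ℝ).1 hW)

lemma diagCongr_smul_one (hW : W ∈ Matrix.orthogonalGroup n ℝ) (c : ℝ) :
    diagCongr W (c • 1) = c • 1 := by
  rw [map_smul, diagCongr_one_right, (Matrix.mem_orthogonalGroup_iff n ℝ).1 hW]

lemma trace_diagCongr_of_mem_orthogonalGroup (hW : W ∈ Matrix.orthogonalGroup n ℝ) (v : n → ℝ) :
    (diagCongr W v).trace = ∑ i, v i := by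
  have hWW : Wᵀ * W = 1 := (Matrix.mem_orthogonalGroup_iff' n ℝ).1 hW
  rw [← Matrix.one_mul (diagCongr W v), trace_mul_diagCongr, Matrix.mul_one, hWW]
  simp only [Matrix.one_apply_eq, one_mul]

lemma det_diagCongr_of_mem_orthogonalGroup (hW : W ∈ Matrix.orthogonalGroup n ℝ) (v : n → ℝ) :
    (diagCongr W v).det = ∏ i, v i := by
  have hdet : (Wᵀ * W).det = 1 := by
    rw [(Matrix.mem_orthogonalGroup_iff' n ℝ).1 hW, Matrix.det_one]
  rw [Matrix.det_mul, Matrix.det_transpose, ← sq] at hdet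
  rw [det_diagCongr, hdet, one_mul]

lemma inv_diagCongr_of_mem_orthogonalGroup (hW : W ∈ Matrix.orthogonalGroup n ℝ)
    (hv : ∀ i, v i ≠ 0) : (diagCongr W v)⁻¹ = diagCongr W v⁻¹ := by
  have hWW : Wᵀ * W = 1 := (Matrix.mem_orthogonalGroup_iff' n ℝ).1 hW
  rw [inv_diagCongr W hv, Matrix.inv_eq_left_inv hWW, Matrix.transpose_transpose]

lemma norm_diagCongr_of_mem_orthogonalGroup (hW : W ∈ Matrix.orthogonalGroup n ℝ) (v : n → ℝ) :
    ‖diagCongr W v‖ = ‖WithLp.toLp 2 v‖ := by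
  have hWW : Wᵀ * W = 1 := (Matrix.mem_orthogonalGroup_iff' n ℝ).1 hW
  rw [← Matrix.frobenius_norm_diagonal, ← sq_eq_sq₀ (norm_nonneg _) (norm_nonneg _),
    norm_sq_eq_trace, norm_sq_eq_trace, Matrix.diagonal_transpose]
  calc ((diagCongr W v)ᵀ * diagCongr W v).trace
      = (W * (Matrix.diagonal v * (Wᵀ * W) * Matrix.diagonal v * Wᵀ)).trace := by
        simp [diagCongr_apply, Matrix.mul_assoc]
    _ = (Matrix.diagonal v * Matrix.diagonal v * (Wᵀ * W)).trace := by
        rw [Matrix.trace_mul_comm, hWW, Matrix.mul_one, Matrix.mul_assoc _ Wᵀ, hWW]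
    _ = _ := by rw [hWW, Matrix.mul_one]

lemma exists_orthogonal_cfc_eq_diagCongr {M : Matrix n n ℝ} (hM : M.IsHermitian) :
    ∃ U ∈ Matrix.orthogonalGroup n ℝ, ∃ v : n → ℝ, ∀ f : ℝ → ℝ, cfc f M = diagCongr U (f ∘ v) := by
  refine ⟨hM.eigenvectorUnitary, hM.eigenvectorUnitary.2, hM.eigenvalues, fun f => ?_⟩
  rw [hM.cfc_eq, Matrix.IsHermitian.cfc, Unitary.conjStarAlgAut_apply]
  rfl

lemma exists_orthogonal_eq_diagCongr {M : Matrix n n ℝ} (hM : M.IsHermitian) :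
    ∃ U ∈ Matrix.orthogonalGroup n ℝ, ∃ v : n → ℝ, M = diagCongr U v := by
  obtain ⟨U, hU, v, hcfc⟩ := exists_orthogonal_cfc_eq_diagCongr hM
  exact ⟨U, hU, v, (cfc_id ℝ M hM).symm.trans (hcfc id)⟩

lemma le_norm_smul_one {Z : Matrix n n ℝ} (hZ : Z.IsSymm) : Z ≤ ‖Z‖ • 1 := by
  obtain ⟨U, hU, v, rfl⟩ := exists_orthogonal_eq_diagCongr hZ
  rw [← diagCongr_smul_one hU]
  refine diagCongr_mono U fun i => ?_
  simpa [norm_diagCongr_of_mem_orthogonalGroup hU] using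
    (le_abs_self (v i)).trans (PiLp.norm_apply_le (WithLp.toLp 2 v) i)

end DiagCongr

lemma exists_pos_smul_one_le {n : Type*} [Finite n] [DecidableEq n] {A : Matrix n n ℝ}
    (hA : A.PosDef) : ∃ a : ℝ, 0 < a ∧ a • 1 ≤ A := by
  cases nonempty_fintype n
  obtain ⟨U, hU, v, rfl⟩ := exists_orthogonal_eq_diagCongr hA.isHermitian
  have hv : ∀ i, 0 < v i := (posDef_diagCongr_iff (isUnit_of_mem_orthogonalGroup hU)).1 hA
  have hsmall : ∀ᶠ a in 𝓝[>] (0 : ℝ), ∀ i, a ≤ v i :=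
    eventually_all.2 fun i => nhdsWithin_le_nhds (eventually_le_nhds (hv i))
  obtain ⟨a, hav, ha⟩ := (hsmall.and self_mem_nhdsWithin).exists
  refine ⟨a, ha, ?_⟩
  rw [← diagCongr_smul_one hU]
  exact diagCongr_mono U fun i => by simpa using hav i

/-! ### Geodesics and the affine-invariant distance -/

section Geometry

variable {d : ℕ} {A B : Mat d}

lemma convex_PD : Convex ℝ (PD d) :=
  convex_iff_forall_pos.2 fun _ hX _ hY _ _ ha hb _ =>
    (Matrix.PosDef.smul hX ha).add (Matrix.PosDef.smul hY hb)

lemma nonneg_of_mem_PD (hA : A ∈ PD d) : 0 ≤ A :=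
  Matrix.nonneg_iff_posSemidef.2 (Matrix.PosDef.posSemidef hA)

lemma isSymm_of_mem_PD (hA : A ∈ PD d) : A.IsSymm := Matrix.PosDef.isHermitian hA

lemma Icc_subset_PD (hA : A ∈ PD d) : Set.Icc A B ⊆ PD d := fun _ hX => posDef_of_le hA hX.1

lemma smul_mem_PD (hA : A ∈ PD d) {c : ℝ} (hc : 0 < c) : c • A ∈ PD d := Matrix.PosDef.smul hA hc

lemma exists_pos_forall_add_mem_Icc (hA : A ∈ PD d) :
    ∃ ε > 0, ∀ B, ∀ X ∈ Set.Icc A B, ∀ Z : Mat d, Z.IsSymm → ‖Z‖ ≤ ε →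
      X + Z ∈ Set.Icc ((1 / 2 : ℝ) • A) (B + (1 / 2 : ℝ) • A) := by
  obtain ⟨a, ha, haA⟩ := exists_pos_smul_one_le hA
  have hle (Z : Mat d) (hZ : Z.IsSymm) (hZa : ‖Z‖ ≤ a / 2) : Z ≤ (1 / 2 : ℝ) • A :=
    calc Z ≤ ‖Z‖ • 1 := le_norm_smul_one hZ
      _ ≤ (a / 2) • 1 := smul_le_smul_of_nonneg_right hZa zero_le_one
      _ = (1 / 2 : ℝ) • a • 1 := by rw [smul_smul]; ring_nf
      _ ≤ (1 / 2 : ℝ) • A := smul_le_smul_of_nonneg_left haA (by norm_num)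
  refine ⟨a / 2, by positivity, fun B X hX Z hZ hZa => ⟨?_, add_le_add hX.2 (hle Z hZ hZa)⟩⟩
  calc (1 / 2 : ℝ) • A = A + -((1 / 2 : ℝ) • A) := by module
    _ ≤ X + Z := add_le_add hX.1 (neg_le.1 (hle (-Z) hZ.neg (by rwa [norm_neg])))

lemma PD_mem_nhdsWithin_isSymm (hA : A ∈ PD d) : PD d ∈ 𝓝[{X : Mat d | X.IsSymm}] A := by
  obtain ⟨ε, hε, hmem⟩ := exists_pos_forall_add_mem_Icc hA
  refine mem_nhdsWithin_iff_exists_mem_nhds_inter.2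
    ⟨Metric.closedBall A ε, Metric.closedBall_mem_nhds A hε, fun X ⟨hX, hXsymm⟩ => ?_⟩
  have h := hmem A A (Set.left_mem_Icc.2 le_rfl) (X - A) (hXsymm.sub (isSymm_of_mem_PD hA))
    (mem_closedBall_iff_norm.1 hX)
  rw [add_sub_cancel] at h
  exact Icc_subset_PD (smul_mem_PD hA one_half_pos) h

lemma mpow_eq_rpow (hA : A ∈ PD d) (t : ℝ) : mpow A t = A ^ t :=
  (CFC.rpow_eq_cfc_real (nonneg_of_mem_PD hA)).symm

lemma mpow_mem_PD (hA : A ∈ PD d) (t : ℝ) : mpow A t ∈ PD d := by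
  rw [mpow_eq_rpow hA]
  exact Matrix.isStrictlyPositive_iff_posDef.1
    (IsStrictlyPositive.rpow A t (Matrix.isStrictlyPositive_iff_posDef.2 hA))

lemma mpow_zero (hA : A ∈ PD d) : mpow A 0 = 1 := by
  rw [mpow_eq_rpow hA, CFC.rpow_zero A (nonneg_of_mem_PD hA)]

lemma mpow_one (hA : A ∈ PD d) : mpow A 1 = A := by
  rw [mpow_eq_rpow hA, CFC.rpow_one A (nonneg_of_mem_PD hA)]

lemma mpow_mul_mpow (hA : A ∈ PD d) (s t : ℝ) : mpow A s * mpow A t = mpow A (s + t) := by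
  simp only [mpow_eq_rpow hA]
  exact (CFC.rpow_add (Matrix.isStrictlyPositive_iff_posDef.2 hA).isUnit).symm

lemma mul_mul_mem_PD (hA : A ∈ PD d) (hB : B ∈ PD d) : A * B * A ∈ PD d := by
  have h := (Matrix.IsUnit.posDef_star_right_conjugate_iff (Matrix.PosDef.isUnit hA)).2 hB
  rwa [Matrix.star_eq_conjTranspose, (Matrix.PosDef.isHermitian hA).eq] at h

lemma exists_congruence (hA : A ∈ PD d) (hB : B ∈ PD d) :
    ∃ (W : Mat d) (v : Fin d → ℝ), IsUnit W ∧ (∀ i, 0 < v i) ∧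
      A = diagCongr W 1 ∧ B = diagCongr W v ∧
      (∀ t, geodesic A B t = diagCongr W fun i => v i ^ t) ∧
      riemDist A B = ‖WithLp.toLp 2 fun i => Real.log (v i)‖ := by
  set P := mpow A (1 / 2) with hP
  set Q := mpow A (-(1 / 2)) with hQ
  have hPsymm : Pᵀ = P := (mpow_mem_PD hA _).isHermitian
  have hPQ : P * Q = 1 := by rw [mpow_mul_mpow hA, add_neg_cancel, mpow_zero hA]
  have hQP : Q * P = 1 := by rw [mpow_mul_mpow hA, neg_add_cancel, mpow_zero hA]
  have hPP : P * P = A := by rw [mpow_mul_mpow hA, add_halves, mpow_one hA]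
  set M := Q * B * Q with hM
  have hPMP : P * M * P = B := by
    calc P * M * P = P * Q * B * (Q * P) := by simp only [hM, Matrix.mul_assoc]
      _ = B := by rw [hPQ, hQP, Matrix.one_mul, Matrix.mul_one]
  have hMpos : M.PosDef := mul_mul_mem_PD (mpow_mem_PD hA _) hB
  obtain ⟨U, hU, v, hcfc⟩ := exists_orthogonal_cfc_eq_diagCongr hMpos.isHermitian
  have hMv : M = diagCongr U v := (cfc_id ℝ M hMpos.isHermitian).symm.trans (hcfc id)
  have hUunit := isUnit_of_mem_orthogonalGroup hU
  refine ⟨P * U, v, (IsUnit.of_mul_eq_one _ hPQ).mul hUunit,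
    (posDef_diagCongr_iff hUunit).1 (hMv ▸ hMpos), ?_, ?_, fun t => ?_, ?_⟩
  · rw [diagCongr_mul, diagCongr_one_right, (Matrix.mem_orthogonalGroup_iff _ ℝ).1 hU, hPsymm,
      Matrix.mul_one, hPP]
  · rw [diagCongr_mul, ← hMv, hPsymm, hPMP]
  · rw [diagCongr_mul, hPsymm, geodesic, ← hP, ← hQ, ← hM, mpow, hcfc]
    rfl
  · rw [riemDist, frobNorm_eq_norm, mlog, ← hQ, ← hM, hcfc,
      norm_diagCongr_of_mem_orthogonalGroup hU]
    rfl

lemma geodesic_mem (hA : A ∈ PD d) (hB : B ∈ PD d) (t : ℝ) : geodesic A B t ∈ PD d := by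
  obtain ⟨W, v, hW, hv, -, -, hgeo, -⟩ := exists_congruence hA hB
  rw [hgeo]
  exact (posDef_diagCongr_iff hW).2 fun i => Real.rpow_pos_of_pos (hv i) t

lemma geodesic_zero (hA : A ∈ PD d) (hB : B ∈ PD d) : geodesic A B 0 = A := by
  obtain ⟨W, v, -, -, hWA, -, hgeo, -⟩ := exists_congruence hA hB
  simp only [hgeo, Real.rpow_zero]
  exact hWA.symm

lemma geodesic_one (hA : A ∈ PD d) (hB : B ∈ PD d) : geodesic A B 1 = B := by
  obtain ⟨W, v, -, -, -, hWB, hgeo, -⟩ := exists_congruence hA hB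
  simp only [hgeo, Real.rpow_one]
  exact hWB.symm

lemma GConvex.geodesic_le {φ : Mat d → ℝ} (hφ : GConvex φ) (hA : A ∈ PD d) (hB : B ∈ PD d)
    {t : ℝ} (ht0 : 0 ≤ t) (ht1 : t ≤ 1) : φ (geodesic A B t) ≤ (1 - t) * φ A + t * φ B := by
  simpa [geodesic_zero hA hB, geodesic_one hA hB] using
    (hφ A hA B hB).2 (Set.left_mem_Icc.2 zero_le_one) (Set.right_mem_Icc.2 zero_le_one)
      (sub_nonneg.2 ht1) ht0 (sub_add_cancel 1 t)

lemma riemDist_self (hA : A ∈ PD d) : riemDist A A = 0 := by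
  have hone : mpow A (-(1 / 2)) * A * mpow A (-(1 / 2)) = 1 := by
    nth_rw 2 [← mpow_one hA]
    rw [mpow_mul_mpow hA, mpow_mul_mpow hA, show -(1 / 2) + 1 + -(1 / 2) = (0 : ℝ) by norm_num,
      mpow_zero hA]
  rw [riemDist, hone, mlog, cfc_apply_one, Real.log_one, map_zero, frobNorm_eq_norm, norm_zero]

lemma mem_Icc_of_riemDist_le {R : ℝ} (hA : A ∈ PD d) (hB : B ∈ PD d) (hR : riemDist A B ≤ R) :
    A ∈ Set.Icc (Real.exp (-R) • B) (Real.exp R • B) := by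
  obtain ⟨W, v, -, hv, hWA, hWB, -, hdist⟩ := exists_congruence hA hB
  have hlog (i) : |Real.log (v i)| ≤ R :=
    (PiLp.norm_apply_le (WithLp.toLp 2 fun i => Real.log (v i)) i).trans (hdist ▸ hR)
  rw [hWA, hWB, ← map_smul, ← map_smul]
  constructor <;> refine diagCongr_mono W fun i => ?_
  · calc Real.exp (-R) * v i = Real.exp (-R + Real.log (v i)) := by
          rw [Real.exp_add, Real.exp_log (hv i)]
      _ ≤ 1 := Real.exp_le_one_iff.2 (by linarith [le_of_abs_le (hlog i)])
  · calc 1 ≤ Real.exp (R + Real.log (v i)) :=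
          Real.one_le_exp (by linarith [neg_le_of_abs_le (hlog i)])
      _ = Real.exp R * v i := by rw [Real.exp_add, Real.exp_log (hv i)]

lemma abs_rpow_sub_one_le {v R t : ℝ} (hv : 0 < v) (hR : |Real.log v| ≤ R) (ht0 : 0 ≤ t)
    (ht1 : t ≤ 1) : |v ^ t - 1| ≤ t * (Real.exp R - 1) := by
  have hvR : v ≤ Real.exp R := (Real.log_le_iff_le_exp hv).1 (le_of_abs_le hR)
  have hupper : v ^ t ≤ 1 + t * (v - 1) := by
    simpa using rpow_one_add_le_one_add_mul_self (s := v - 1) (by linarith) ht0 ht1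
  have hlower : 1 + t * Real.log v ≤ v ^ t := by
    rw [Real.rpow_def_of_pos hv]
    linarith [Real.add_one_le_exp (Real.log v * t)]
  have hlog : -(Real.exp R - 1) ≤ Real.log v := by
    linarith [neg_le_of_abs_le hR, Real.add_one_le_exp R]
  rw [abs_le]
  constructor
  · linarith [mul_le_mul_of_nonneg_left hlog ht0]
  · linarith [mul_le_mul_of_nonneg_left (sub_le_sub_right hvR 1) ht0]

/-- A bound for the Euclidean speed at `A` of the geodesics from `A` to `B`, over all `A` at
affine-invariant distance at most `R` from `B`. -/
def speedBound (B : Mat d) (R : ℝ) : ℝ := (Real.exp R - 1) * (Real.exp R * ‖B‖)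

lemma norm_geodesic_sub_le {R t : ℝ} (hA : A ∈ PD d) (hB : B ∈ PD d) (hR : riemDist A B ≤ R)
    (ht0 : 0 ≤ t) (ht1 : t ≤ 1) : ‖geodesic A B t - A‖ ≤ t * speedBound B R := by
  obtain ⟨W, v, -, hv, hWA, -, hgeo, hdist⟩ := exists_congruence hA hB
  have hlog (i) : |Real.log (v i)| ≤ R :=
    (PiLp.norm_apply_le (WithLp.toLp 2 fun i => Real.log (v i)) i).trans (hdist ▸ hR)
  have hAnonneg := nonneg_of_mem_PD hA
  have hR0 : 0 ≤ R := (hdist ▸ norm_nonneg _ : 0 ≤ riemDist A B).trans hR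
  set c := t * (Real.exp R - 1) with hc
  have hc0 : 0 ≤ c := mul_nonneg ht0 (sub_nonneg.2 (Real.one_le_exp hR0))
  have hpow (i) := abs_le.1 (abs_rpow_sub_one_le (hv i) (hlog i) ht0 ht1)
  have hgeoA : geodesic A B t - A = diagCongr W fun i => v i ^ t - 1 := by
    rw [hgeo, hWA, ← map_sub]
    rfl
  have hcA : c • A = diagCongr W (c • 1) := by rw [hWA, ← map_smul]
  have hdiff : ‖geodesic A B t - A‖ ≤ ‖c • A‖ := by
    refine norm_le_norm_of_neg_le_of_le (Matrix.IsSymm.smul (isSymm_of_mem_PD hA) c) ?_ ?_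
    · rw [hgeoA, hcA, ← map_neg]
      exact diagCongr_mono W fun i => by simpa using (hpow i).1
    · rw [hgeoA, hcA]
      exact diagCongr_mono W fun i => by simpa using (hpow i).2
  have hnorm : ‖A‖ ≤ Real.exp R * ‖B‖ := by
    rw [← abs_of_pos (Real.exp_pos R), ← Real.norm_eq_abs, ← norm_smul]
    have hAB := (mem_Icc_of_riemDist_le hA hB hR).2
    exact norm_le_norm_of_neg_le_of_le (Matrix.IsSymm.smul (isSymm_of_mem_PD hB) _)
      ((neg_nonpos.2 (hAnonneg.trans hAB)).trans hAnonneg) hAB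
  calc ‖geodesic A B t - A‖ ≤ c * ‖A‖ := by rwa [norm_smul, Real.norm_of_nonneg hc0] at hdiff
    _ ≤ c * (Real.exp R * ‖B‖) := by gcongr
    _ = t * speedBound B R := by rw [hc, speedBound, mul_assoc]

lemma spectrum_subset_Ioi (hA : A ∈ PD d) : spectrum ℝ A ⊆ Set.Ioi 0 := fun _ hx =>
  (Matrix.isStrictlyPositive_iff_posDef.2 hA).spectrum_pos hx

open scoped Matrix.Norms.L2Operator in
lemma continuousOn_cfc_PD {f : ℝ → ℝ} (hf : ContinuousOn f (Set.Ioi 0)) :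
    ContinuousOn (fun X : Mat d => cfc f X) (PD d) :=
  ContinuousOn.cfc_of_mem_nhdsSet f (s := Set.Ioi 0) (a := id)
    (isOpen_Ioi.mem_nhdsSet.2 (Set.iUnion₂_subset fun _ hX => spectrum_subset_Ioi hX))
    continuousOn_id (fun _ hX => Matrix.PosDef.isHermitian hX) hf

lemma continuousOn_riemDist_left (hB : B ∈ PD d) : ContinuousOn (fun X => riemDist X B) (PD d) := by
  have hpow : ContinuousOn (fun X : Mat d => mpow X (-(1 / 2))) (PD d) :=
    continuousOn_cfc_PD fun x hx =>
      (Real.continuousAt_rpow_const x _ (Or.inl (ne_of_gt hx))).continuousWithinAt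
  have hlog : ContinuousOn (fun X : Mat d => mlog X) (PD d) :=
    continuousOn_cfc_PD (Real.continuousOn_log.mono fun _ hx => ne_of_gt hx)
  simp only [riemDist, frobNorm_eq_norm]
  exact (hlog.comp ((hpow.mul continuousOn_const).mul hpow) fun X hX =>
    mul_mul_mem_PD (mpow_mem_PD hX _) hB).norm

end Geometry

/-! ### Convex functions on the cone and their gradients -/

section FrobInner

variable {d : ℕ}

lemma frobInner_self (A : Mat d) : frobInner A A = ‖A‖ ^ 2 := (norm_sq_eq_trace A).symm

lemma frobInner_add_left (A B C : Mat d) :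
    frobInner (A + B) C = frobInner A C + frobInner B C := by
  simp [frobInner, Matrix.add_mul]

lemma frobInner_sub_left (A B C : Mat d) :
    frobInner (A - B) C = frobInner A C - frobInner B C := by
  simp [frobInner, Matrix.sub_mul]

lemma frobInner_neg_left (A C : Mat d) : frobInner (-A) C = -frobInner A C := by
  simp [frobInner]

lemma frobInner_smul_left (c : ℝ) (A C : Mat d) : frobInner (c • A) C = c * frobInner A C := by
  simp [frobInner]

lemma frobInner_add_right (A B C : Mat d) :
    frobInner A (B + C) = frobInner A B + frobInner A C := by
  simp [frobInner, Matrix.mul_add]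

lemma frobInner_neg_right (A C : Mat d) : frobInner A (-C) = -frobInner A C := by
  simp [frobInner]

lemma frobInner_smul_right (c : ℝ) (A C : Mat d) : frobInner A (c • C) = c * frobInner A C := by
  simp [frobInner]

lemma frobInner_zero_right (A : Mat d) : frobInner A 0 = 0 := by
  simp [frobInner]

lemma abs_frobInner_le (A B : Mat d) : |frobInner A B| ≤ ‖A‖ * ‖B‖ := by
  have hsum (A B : Mat d) : frobInner A B = ∑ p : Fin d × Fin d, A p.2 p.1 * B p.2 p.1 := by
    simp only [frobInner, Matrix.trace, Matrix.diag_apply, Matrix.mul_apply,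
      Matrix.transpose_apply, Fintype.sum_prod_type]
  refine abs_le_of_sq_le_sq ?_ (by positivity)
  rw [mul_pow, ← frobInner_self, ← frobInner_self, hsum, hsum, hsum]
  simpa only [sq] using Finset.sum_mul_sq_le_sq_mul_sq Finset.univ
    (fun p : Fin d × Fin d => A p.2 p.1) fun p => B p.2 p.1

lemma frobInner_le (A B : Mat d) : frobInner A B ≤ ‖A‖ * ‖B‖ :=
  (le_abs_self _).trans (abs_frobInner_le A B)

end FrobInner

section Convex

variable {d : ℕ} {f h : Mat d → ℝ} {G G' X Y V : Mat d}

/-- The projection `A ↦ (A + Aᵀ) / 2` onto the symmetric matrices. It turns the cone, which has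
empty interior among all matrices, into an open set. -/
def symPart (d : ℕ) : Mat d →ₗ[ℝ] Mat d :=
  (1 / 2 : ℝ) • (LinearMap.id + (Matrix.transposeLinearEquiv (Fin d) (Fin d) ℝ ℝ).toLinearMap)

lemma symPart_apply (A : Mat d) : symPart d A = (1 / 2 : ℝ) • (A + Aᵀ) := rfl

lemma isSymm_symPart (A : Mat d) : (symPart d A).IsSymm := by
  rw [symPart_apply, Matrix.IsSymm, Matrix.transpose_smul, Matrix.transpose_add,
    Matrix.transpose_transpose, add_comm]

lemma symPart_of_mem_PD (hX : X ∈ PD d) : symPart d X = X := by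
  rw [symPart_apply, (isSymm_of_mem_PD hX).eq]
  module

lemma isOpen_preimage_symPart : IsOpen (symPart d ⁻¹' PD d) := by
  refine isOpen_iff_mem_nhds.2 fun A hA => ?_
  have htendsto : Tendsto (symPart d) (𝓝 A) (𝓝[{X | X.IsSymm}] (symPart d A)) :=
    tendsto_nhdsWithin_iff.2 ⟨(symPart d).continuous_of_finiteDimensional.tendsto A,
      Eventually.of_forall isSymm_symPart⟩
  exact htendsto (PD_mem_nhdsWithin_isSymm hA)

lemma continuousOn_of_convexOn_PD (hf : ConvexOn ℝ (PD d) f) : ContinuousOn f (PD d) := by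
  have hcont : ContinuousOn (f ∘ symPart d) (symPart d ⁻¹' PD d) :=
    (hf.comp_linearMap (symPart d)).continuousOn isOpen_preimage_symPart
  refine (hcont.mono fun X hX => ?_).congr fun X hX => ?_
  · rwa [Set.mem_preimage, symPart_of_mem_PD hX]
  · rw [Function.comp_apply, symPart_of_mem_PD hX]

lemma tendsto_add_smul_nhdsWithin_PD (hX : X ∈ PD d) (hV : V.IsSymm) :
    Tendsto (fun t : ℝ => X + t • V) (𝓝 0) (𝓝[PD d] X) := by
  have hline : Tendsto (fun t : ℝ => X + t • V) (𝓝 0) (𝓝[{X | X.IsSymm}] X) := by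
    refine tendsto_nhdsWithin_iff.2
      ⟨?_, Eventually.of_forall fun t => (isSymm_of_mem_PD hX).add (hV.smul t)⟩
    simpa using (show Continuous fun t : ℝ => X + t • V by fun_prop).tendsto 0
  exact tendsto_nhdsWithin_iff.2 ⟨hline.mono_right nhdsWithin_le_nhds,
    hline (PD_mem_nhdsWithin_isSymm hX)⟩

lemma IsEuclGradAt.tendsto_slope (hG : IsEuclGradAt h G X) (hX : X ∈ PD d) (hV : V.IsSymm) :
    Tendsto (fun t : ℝ => (h (X + t • V) - h X) / t) (𝓝[>] 0) (𝓝 (frobInner G V)) := by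
  have hline := (tendsto_add_smul_nhdsWithin_PD hX hV).mono_left
    (nhdsWithin_le_nhds (s := Set.Ioi 0))
  have hlittle : (fun t : ℝ => h (X + t • V) - h X - t * frobInner G V) =o[𝓝[>] 0]
      fun t : ℝ => t := by
    have hcomp := hG.2.comp_tendsto hline
    simp only [Function.comp_def, add_sub_cancel_left, frobInner_smul_right, frobNorm_eq_norm,
      norm_smul] at hcomp
    refine hcomp.trans_isBigO (Asymptotics.IsBigO.of_bound ‖V‖ (Eventually.of_forall fun t => ?_))
    rw [norm_mul, norm_norm, norm_norm, mul_comm]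
  have hlim := hlittle.tendsto_div_nhds_zero.add_const (frobInner G V)
  rw [zero_add] at hlim
  refine hlim.congr' ?_
  filter_upwards [self_mem_nhdsWithin] with t (ht : 0 < t)
  field_simp
  ring

lemma IsEuclGradAt.add_le (hG : IsEuclGradAt h G X) (hh : ConvexOn ℝ (PD d) h) (hX : X ∈ PD d)
    (hY : Y ∈ PD d) : h X + frobInner G (Y - X) ≤ h Y := by
  have hslope : ∀ᶠ t in 𝓝[>] (0 : ℝ), (h (X + t • (Y - X)) - h X) / t ≤ h Y - h X := by
    filter_upwards [Ioo_mem_nhdsGT (zero_lt_one' ℝ)] with t ⟨ht0, ht1⟩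
    have hconv := hh.2 hX hY (sub_nonneg.2 ht1.le) ht0.le (sub_add_cancel 1 t)
    rw [show (1 - t) • X + t • Y = X + t • (Y - X) by module, smul_eq_mul, smul_eq_mul] at hconv
    rw [div_le_iff₀ ht0]
    linarith
  linarith [le_of_tendsto
    (hG.tendsto_slope hX ((isSymm_of_mem_PD hY).sub (isSymm_of_mem_PD hX))) hslope]

lemma IsEuclGradAt.unique (hG : IsEuclGradAt h G X) (hG' : IsEuclGradAt h G' X) (hX : X ∈ PD d) :
    G = G' := by
  have hV : (G - G').IsSymm := hG.1.sub hG'.1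
  have heq := tendsto_nhds_unique (hG.tendsto_slope hX hV) (hG'.tendsto_slope hX hV)
  rwa [← sub_eq_zero, ← frobInner_sub_left, frobInner_self, sq_eq_zero_iff, norm_eq_zero,
    sub_eq_zero] at heq

lemma IsEuclGradAt.euclGrad_eq (hG : IsEuclGradAt h G X) (hX : X ∈ PD d) : euclGrad h X = G := by
  have hex : ∃ G, IsEuclGradAt h G X := ⟨G, hG⟩
  rw [euclGrad, dif_pos hex]
  exact hex.choose_spec.unique hG hX

lemma SmoothOnPD.isEuclGradAt (hh : SmoothOnPD h) (hX : X ∈ PD d) :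
    IsEuclGradAt h (euclGrad h X) X := by
  obtain ⟨G, hG⟩ := hh.1 X hX
  rwa [hG.euclGrad_eq hX]

lemma SmoothOnPD.locallyLipschitzOn (hh : SmoothOnPD h) :
    LocallyLipschitzOn (PD d) (euclGrad h) := by
  intro X hX
  obtain ⟨r, hr, L, hL⟩ := hh.2 X hX
  refine ⟨L.toNNReal, PD d ∩ Metric.ball X r,
    inter_mem_nhdsWithin _ (Metric.ball_mem_nhds X hr), ?_⟩
  simp only [LipschitzGradOn, frobNorm_eq_norm] at hL
  refine LipschitzOnWith.of_dist_le_mul fun Y hY Z hZ => ?_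
  rw [dist_eq_norm, dist_eq_norm]
  exact (hL Y ⟨hY.1, mem_ball_iff_norm.1 hY.2⟩ Z ⟨hZ.1, mem_ball_iff_norm.1 hZ.2⟩).trans
    (by gcongr; exact Real.le_coe_toNNReal L)

lemma SmoothOnPD.exists_lipschitzGradOn (hh : SmoothOnPD h) {K : Set (Mat d)} (hK : IsCompact K)
    (hKP : K ⊆ PD d) : ∃ L : ℝ, 0 ≤ L ∧ LipschitzGradOn h L K := by
  obtain ⟨L, hL⟩ := (hh.locallyLipschitzOn.mono hKP).exists_lipschitzOnWith_of_compact hK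
  refine ⟨L, L.2, fun X hX Y hY => ?_⟩
  simpa only [frobNorm_eq_norm, dist_eq_norm] using hL.dist_le_mul X hX Y hY

/-- `g` selects a symmetric subgradient of `h` at each positive definite matrix. -/
structure IsSubgradient (h : Mat d → ℝ) (g : Mat d → Mat d) : Prop where
  isSymm : ∀ X ∈ PD d, (g X).IsSymm
  add_le : ∀ X ∈ PD d, ∀ Y ∈ PD d, h X + frobInner (g X) (Y - X) ≤ h Y

namespace IsSubgradient

variable {h' : Mat d → ℝ} {g g' : Mat d → Mat d}

lemma add (hg : IsSubgradient h g) (hg' : IsSubgradient h' g') :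
    IsSubgradient (fun X => h X + h' X) fun X => g X + g' X where
  isSymm X hX := (hg.isSymm X hX).add (hg'.isSymm X hX)
  add_le X hX Y hY := by
    rw [frobInner_add_left]
    linarith [hg.add_le X hX Y hY, hg'.add_le X hX Y hY]

lemma smul (hg : IsSubgradient h g) {c : ℝ} (hc : 0 ≤ c) :
    IsSubgradient (fun X => c * h X) fun X => c • g X where
  isSymm X hX := (hg.isSymm X hX).smul c
  add_le X hX Y hY := by
    rw [frobInner_smul_left, ← mul_add]
    exact mul_le_mul_of_nonneg_left (hg.add_le X hX Y hY) hc

lemma congr_add_const (hg : IsSubgradient h g) (c : ℝ) (hh : ∀ X ∈ PD d, h' X = h X + c) :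
    IsSubgradient h' g where
  isSymm := hg.isSymm
  add_le X hX Y hY := by
    rw [hh X hX, hh Y hY]
    linarith [hg.add_le X hX Y hY]

lemma comp_add_right (hg : IsSubgradient h g) {T : Mat d} (hT : T ∈ PD d) :
    IsSubgradient (fun X => h (X + T)) fun X => g (X + T) where
  isSymm X hX := hg.isSymm (X + T) (hX.add hT)
  add_le X hX Y hY := by
    simpa using hg.add_le (X + T) (hX.add hT) (Y + T) (hY.add hT)

lemma sub_le (hg : IsSubgradient h g) (hX : X ∈ PD d) (hY : Y ∈ PD d) :
    h Y - h X ≤ frobInner (g Y) (Y - X) := by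
  have hle := hg.add_le Y hY X hX
  rw [← neg_sub Y X, frobInner_neg_right] at hle
  linarith

lemma convexOn (hg : IsSubgradient h g) : ConvexOn ℝ (PD d) h := by
  refine ⟨convex_PD, fun X hX Y hY s t hs ht hst => ?_⟩
  have hZ : s • X + t • Y ∈ PD d := convex_PD hX hY hs ht hst
  set Z := s • X + t • Y with hZdef
  have hbalance : s * frobInner (g Z) (X - Z) + t * frobInner (g Z) (Y - Z) = 0 := by
    have hsum : s • (X - Z) + t • (Y - Z) = (1 - (s + t)) • Z := by rw [hZdef]; module
    rw [← frobInner_smul_right, ← frobInner_smul_right, ← frobInner_add_right, hsum, hst, sub_self,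
      zero_smul, frobInner_zero_right]
  calc h Z = s * (h Z + frobInner (g Z) (X - Z)) + t * (h Z + frobInner (g Z) (Y - Z)) := by
        linear_combination -h Z * hst - hbalance
    _ ≤ s * h X + t * h Y := by
        gcongr
        exacts [hg.add_le Z hZ X hX, hg.add_le Z hZ Y hY]

lemma isEuclGradAt (hg : IsSubgradient h g) (hcont : ContinuousOn g (PD d)) (hX : X ∈ PD d) :
    IsEuclGradAt h (g X) X := by
  refine ⟨hg.isSymm X hX, Asymptotics.isLittleO_iff.2 fun c hc => ?_⟩
  have hclose : ∀ᶠ Y in 𝓝[PD d] X, ‖g Y - g X‖ < c := by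
    simpa only [dist_eq_norm] using (hcont X hX).eventually (Metric.ball_mem_nhds _ hc)
  filter_upwards [hclose, self_mem_nhdsWithin] with Y hYX hY
  have hlower : 0 ≤ h Y - h X - frobInner (g X) (Y - X) := by linarith [hg.add_le X hX Y hY]
  rw [Real.norm_of_nonneg hlower, frobNorm_eq_norm, norm_norm]
  calc h Y - h X - frobInner (g X) (Y - X) ≤ frobInner (g Y - g X) (Y - X) := by
        rw [frobInner_sub_left]
        linarith [hg.sub_le hX hY]
    _ ≤ ‖g Y - g X‖ * ‖Y - X‖ := frobInner_le _ _
    _ ≤ c * ‖Y - X‖ := by gcongr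

lemma smoothOnPD (hg : IsSubgradient h g) (hlip : LocallyLipschitzOn (PD d) g) :
    SmoothOnPD h := by
  have hgrad : ∀ X ∈ PD d, IsEuclGradAt h (g X) X := fun X hX =>
    hg.isEuclGradAt hlip.continuousOn hX
  refine ⟨fun X hX => ⟨g X, hgrad X hX⟩, fun X hX => ?_⟩
  obtain ⟨L, U, hU, hL⟩ := hlip hX
  obtain ⟨r, hr, hball⟩ := Metric.mem_nhdsWithin_iff.1 hU
  refine ⟨r, hr, L, fun Y hY Z hZ => ?_⟩
  have hmem : ∀ Y ∈ {Y ∈ PD d | frobNorm (Y - X) < r}, Y ∈ U := fun Y hY =>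
    hball ⟨mem_ball_iff_norm.2 (frobNorm_eq_norm (Y - X) ▸ hY.2), hY.1⟩
  rw [(hgrad Y hY.1).euclGrad_eq hY.1, (hgrad Z hZ.1).euclGrad_eq hZ.1]
  simpa only [frobNorm_eq_norm, dist_eq_norm] using
    hL.dist_le_mul Y (hmem Y hY) Z (hmem Z hZ)

end IsSubgradient

end Convex

/-! ### Convergence of the convex-concave procedure -/

section MinimizingSequences

lemma eventually_mem_of_tendsto_of_isCompact {α ι : Type*} [TopologicalSpace α] {K U : Set α}
    {φ : α → ℝ} {m : ℝ} {l : Filter ι} {x : ι → α} (hK : IsCompact K) (hφ : ContinuousOn φ K)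
    (hU : ∀ a ∈ K, φ a ≤ m → U ∈ 𝓝[K] a) (hx : ∀ᶠ i in l, x i ∈ K)
    (hlim : Tendsto (fun i => φ (x i)) l (𝓝 m)) : ∀ᶠ i in l, x i ∈ U := by
  change U ∈ map x l
  refine Filter.mem_iff_ultrafilter.2 fun F hF => ?_
  obtain ⟨a, ha, hFa⟩ := hK.ultrafilter_le_nhds F (le_principal_iff.2 (hF hx))
  have hFK : (F : Filter α) ≤ 𝓝[K] a := le_inf hFa (le_principal_iff.2 (hF hx))
  have hφa : φ a = m :=
    tendsto_nhds_unique ((hφ a ha).tendsto.mono_left hFK) ((tendsto_map'_iff.2 hlim).mono_left hF)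
  exact hFK (hU a ha hφa.le)

variable {d : ℕ} {φ : Mat d → ℝ} {K : Set (Mat d)} {A X Xs : Mat d} {x : ℕ → Mat d}

lemma exists_isMinimizer (hφ : ContinuousOn φ (PD d)) (hK : IsCompact K) (hKP : K ⊆ PD d)
    (hX : X ∈ K) (hsub : ∀ Y ∈ PD d, φ Y ≤ φ X → Y ∈ K) : ∃ Y, IsMinimizer φ Y := by
  obtain ⟨Z, hZ, hmin⟩ := hK.exists_isMinOn ⟨X, hX⟩ (hφ.mono hKP)
  refine ⟨Z, hKP hZ, fun Y hY => ?_⟩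
  rcases le_total (φ Y) (φ X) with hYX | hXY
  · exact hmin (hsub Y hY hYX)
  · exact (hmin hX).trans hXY

lemma IsMinimizer.of_le (hXs : IsMinimizer φ Xs) (hA : A ∈ PD d) (hle : φ A ≤ φ Xs) :
    IsMinimizer φ A :=
  ⟨hA, fun Y hY => hle.trans (hXs.2 Y hY)⟩

lemma IsMinimizer.eventually_riemDist_lt (hXs : IsMinimizer φ Xs) (hφ : ContinuousOn φ (PD d))
    (hK : IsCompact K) (hKP : K ⊆ PD d) (hx : ∀ k, x k ∈ K)
    (hlim : Tendsto (fun k => φ (x k)) atTop (𝓝 (φ Xs))) {ε : ℝ} (hε : 0 < ε) :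
    ∀ᶠ k in atTop, ∃ Y, IsMinimizer φ Y ∧ riemDist (x k) Y < ε := by
  refine eventually_mem_of_tendsto_of_isCompact (U := {A | ∃ Y, IsMinimizer φ Y ∧ riemDist A Y < ε})
    hK (hφ.mono hKP) (fun A hA hle => ?_) (Eventually.of_forall hx) hlim
  have hAP := hKP hA
  have hball : ∀ᶠ B in 𝓝[K] A, riemDist B A < ε :=
    ((continuousOn_riemDist_left hAP).mono hKP A hA).eventually_lt_const
      ((riemDist_self hAP).trans_lt hε)
  exact hball.mono fun B hB => ⟨A, hXs.of_le hAP hle, hB⟩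

lemma IsMinimizer.tendsto_of_unique (hXs : IsMinimizer φ Xs) (hφ : ContinuousOn φ (PD d))
    (huniq : ∀ Y, IsMinimizer φ Y → Y = Xs) (hK : IsCompact K) (hKP : K ⊆ PD d)
    (hx : ∀ k, x k ∈ K) (hlim : Tendsto (fun k => φ (x k)) atTop (𝓝 (φ Xs))) :
    Tendsto x atTop (𝓝 Xs) := fun U hU =>
  eventually_mem_of_tendsto_of_isCompact (x := x) hK (hφ.mono hKP)
    (fun A hA hle => by
      rw [huniq A (hXs.of_le (hKP hA) hle)]
      exact nhdsWithin_le_nhds hU)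
    (Eventually.of_forall hx) hlim

end MinimizingSequences

section Rate

lemma le_div_of_forall_le {Δ : ℕ → ℝ} {C : ℝ} (hC : 0 ≤ C)
    (hΔ : ∀ k, ∀ t : ℝ, 0 ≤ t → t ≤ 1 → Δ (k + 1) ≤ (1 - t) * Δ k + C * t ^ 2) {k : ℕ}
    (hk : 1 ≤ k) : Δ k ≤ 4 * C / (k + 2) := by
  induction k, hk using Nat.le_induction with
  | base =>
    have hstep := hΔ 0 1 zero_le_one le_rfl
    norm_num at hstep ⊢
    linarith
  | succ k hk ih =>
    have ht1 : (2 : ℝ) / (k + 2) ≤ 1 := by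
      rw [div_le_one (by positivity)]
      linarith [k.cast_nonneg (α := ℝ)]
    have hfrac : ((k : ℝ) + 1) / (k + 2) ^ 2 ≤ 1 / (k + 3) := by
      rw [div_le_div_iff₀ (by positivity) (by positivity)]
      nlinarith
    calc Δ (k + 1) ≤ (1 - 2 / ((k : ℝ) + 2)) * Δ k + C * (2 / (k + 2)) ^ 2 :=
          hΔ k _ (by positivity) ht1
      _ ≤ (1 - 2 / ((k : ℝ) + 2)) * (4 * C / (k + 2)) + C * (2 / (k + 2)) ^ 2 := by
          have := sub_nonneg.2 ht1
          gcongr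
      _ = 4 * C * ((k + 1) / (k + 2) ^ 2) := by field_simp; ring
      _ ≤ 4 * C * (1 / (k + 3)) := by gcongr
      _ = 4 * C / (↑(k + 1) + 2) := by push_cast; ring

lemma tendsto_const_div_natCast_add (C a : ℝ) :
    Tendsto (fun k : ℕ => C / ((k : ℝ) + a)) atTop (𝓝 0) :=
  tendsto_const_nhds.div_atTop (tendsto_atTop_add_const_right _ a tendsto_natCast_atTop_atTop)

end Rate

section CCCP

variable {d : ℕ} {φ f h : Mat d → ℝ} {A B X X₀ Xs Y : Mat d}

lemma isCompact_sublevel (hφ : ContinuousOn φ (PD d)) (hA : A ∈ PD d)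
    (hsub : sublevel φ X₀ ⊆ Set.Icc A B) : IsCompact (sublevel φ X₀) := by
  have hset : sublevel φ X₀ = Set.Icc A B ∩ φ ⁻¹' Set.Iic (φ X₀) :=
    Set.Subset.antisymm (fun X hX => ⟨hsub hX, hX.2⟩) fun X hX => ⟨Icc_subset_PD hA hX.1, hX.2⟩
  have hcompact := isCompact_Icc_matrix A B
  rw [hset]
  exact hcompact.of_isClosed_subset ((hφ.mono (Icc_subset_PD hA)).preimage_isClosed_of_isClosed
    hcompact.isClosed isClosed_Iic) Set.inter_subset_left

lemma exists_riemDist_le_of_isCompact {K : Set (Mat d)} (hK : IsCompact K) (hKP : K ⊆ PD d)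
    (hB : B ∈ PD d) : ∃ R, ∀ Y ∈ K, riemDist Y B ≤ R := by
  obtain ⟨R, hR⟩ := hK.bddAbove_image ((continuousOn_riemDist_left hB).mono hKP)
  exact ⟨R, fun Y hY => hR (Set.mem_image_of_mem _ hY)⟩

namespace IsDC

lemma continuousOn (hdc : IsDC φ f h) : ContinuousOn φ (PD d) :=
  ((continuousOn_of_convexOn_PD hdc.convex_f).sub (continuousOn_of_convexOn_PD hdc.convex_h)).congr
    hdc.eq_sub

lemma isSubgradient (hdc : IsDC φ f h) : IsSubgradient h (euclGrad h) where
  isSymm _ hX := (hdc.smooth_h.isEuclGradAt hX).1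
  add_le _ hX _ hY := (hdc.smooth_h.isEuclGradAt hX).add_le hdc.convex_h hX hY

lemma le_surrogate (hdc : IsDC φ f h) (hX : X ∈ PD d) (hY : Y ∈ PD d) :
    φ X ≤ surrogate f h X Y := by
  rw [hdc.eq_sub X hX, surrogate]
  linarith [hdc.isSubgradient.add_le Y hY X hX]

lemma surrogate_self (hdc : IsDC φ f h) (hX : X ∈ PD d) : surrogate f h X X = φ X := by
  rw [hdc.eq_sub X hX, surrogate, sub_self, frobInner_zero_right, sub_zero]

lemma surrogate_le (hdc : IsDC φ f h) (hX : X ∈ PD d) (hY : Y ∈ PD d) :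
    surrogate f h X Y ≤ φ X + ‖euclGrad h X - euclGrad h Y‖ * ‖X - Y‖ := by
  have hinner := frobInner_le (euclGrad h X - euclGrad h Y) (X - Y)
  rw [frobInner_sub_left] at hinner
  rw [hdc.eq_sub X hX, surrogate]
  linarith [hdc.isSubgradient.sub_le hY hX]

lemma continuousOn_surrogate (hdc : IsDC φ f h) (Y : Mat d) :
    ContinuousOn (fun X => surrogate f h X Y) (PD d) := by
  have hf := continuousOn_of_convexOn_PD hdc.convex_f
  unfold surrogate frobInner
  fun_prop

lemma le_of_surrogate_le (hdc : IsDC φ f h) (hX : X ∈ PD d) (hY : Y ∈ PD d)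
    (hle : surrogate f h X Y ≤ surrogate f h Y Y) : φ X ≤ φ Y :=
  (hdc.le_surrogate hX hY).trans (hle.trans (hdc.surrogate_self hY).le)

lemma exists_isCCCP (hdc : IsDC φ f h) (hX₀ : X₀ ∈ PD d) (hS : IsCompact (sublevel φ X₀)) :
    ∃ X, IsCCCP f h X₀ X := by
  have hstep : ∀ Y : sublevel φ X₀, ∃ Z : sublevel φ X₀,
      IsMinimizer (fun X => surrogate f h X Y) Z := by
    rintro ⟨Y, hY⟩
    obtain ⟨Z, hZ⟩ := exists_isMinimizer (hdc.continuousOn_surrogate Y) hS (fun X hX => hX.1) hY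
      fun X hX hle => ⟨hX, (hdc.le_of_surrogate_le hX hY.1 hle).trans hY.2⟩
    exact ⟨⟨Z, hZ.1, (hdc.le_of_surrogate_le hZ.1 hY.1 (hZ.2 _ hY.1)).trans hY.2⟩, hZ⟩
  choose next hnext using hstep
  refine ⟨fun k => next^[k] ⟨X₀, hX₀, le_rfl⟩, rfl, fun k => ?_⟩
  simp only [Function.iterate_succ_apply']
  exact hnext _

end IsDC

namespace IsCCCP

variable {x : ℕ → Mat d} {R L : ℝ}

lemma mem_sublevel (hx : IsCCCP f h X₀ x) (hdc : IsDC φ f h) (hX₀ : X₀ ∈ PD d) (k : ℕ) :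
    x k ∈ sublevel φ X₀ := by
  induction k with
  | zero =>
    rw [hx.1]
    exact ⟨hX₀, le_rfl⟩
  | succ k ih =>
    obtain ⟨hmem, hmin⟩ := hx.2 k
    exact ⟨hmem, (hdc.le_of_surrogate_le hmem ih.1 (hmin _ ih.1)).trans ih.2⟩

/- The surrogate is compared with its value at the point `t` of the geodesic from `x k` to a
minimizer: there `φ` has decreased by g-convexity, and the surrogate exceeds `φ` by `O(t²)`. -/
lemma sub_le_of_gConvex (hx : IsCCCP f h X₀ x) (hg : GConvex φ) (hdc : IsDC φ f h)
    (hX₀ : X₀ ∈ PD d) (hXs : IsMinimizer φ Xs) (hR : ∀ Y ∈ sublevel φ X₀, riemDist Y Xs ≤ R)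
    (hL0 : 0 ≤ L) (hL : LipschitzGradOn h L (convexHull ℝ (sublevel φ X₀))) (k : ℕ) {t : ℝ}
    (ht0 : 0 ≤ t) (ht1 : t ≤ 1) :
    φ (x (k + 1)) - φ Xs ≤ (1 - t) * (φ (x k) - φ Xs) + L * speedBound Xs R ^ 2 * t ^ 2 := by
  have hk := hx.mem_sublevel hdc hX₀ k
  set Z := geodesic (x k) Xs t
  have hZP : Z ∈ PD d := geodesic_mem hk.1 hXs.1 t
  have hconv : φ Z ≤ (1 - t) * φ (x k) + t * φ Xs := hg.geodesic_le hk.1 hXs.1 ht0 ht1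
  have hZS : Z ∈ sublevel φ X₀ :=
    ⟨hZP, by nlinarith [mul_le_mul_of_nonneg_left (hXs.2 _ hk.1) ht0, hk.2]⟩
  have hlip := hL Z (subset_convexHull ℝ _ hZS) (x k) (subset_convexHull ℝ _ hk)
  rw [frobNorm_eq_norm, frobNorm_eq_norm] at hlip
  have hexcess : ‖euclGrad h Z - euclGrad h (x k)‖ * ‖Z - x k‖ ≤
      L * speedBound Xs R ^ 2 * t ^ 2 := by
    calc _ ≤ L * ‖Z - x k‖ * ‖Z - x k‖ := by gcongr
      _ = L * ‖Z - x k‖ ^ 2 := by ring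
      _ ≤ L * (t * speedBound Xs R) ^ 2 := by
          gcongr
          exact norm_geodesic_sub_le hk.1 hXs.1 (hR _ hk) ht0 ht1
      _ = _ := by ring
  have hstep : φ (x (k + 1)) ≤ surrogate f h Z (x k) :=
    (hdc.le_surrogate (hx.2 k).1 hk.1).trans ((hx.2 k).2 Z hZP)
  linarith [hdc.surrogate_le hZP hk.1]

lemma sub_le_div (hx : IsCCCP f h X₀ x) (hg : GConvex φ) (hdc : IsDC φ f h) (hX₀ : X₀ ∈ PD d)
    (hXs : IsMinimizer φ Xs) (hR : ∀ Y ∈ sublevel φ X₀, riemDist Y Xs ≤ R) (hL0 : 0 ≤ L)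
    (hL : LipschitzGradOn h L (convexHull ℝ (sublevel φ X₀))) {k : ℕ} (hk : 1 ≤ k) :
    φ (x k) - φ Xs ≤ 2 * L * (Real.sqrt 2 * speedBound Xs R) ^ 2 / (k + 2) := by
  refine (le_div_of_forall_le (Δ := fun k => φ (x k) - φ Xs)
    (mul_nonneg hL0 (sq_nonneg (speedBound Xs R)))
    (fun k _ => hx.sub_le_of_gConvex hg hdc hX₀ hXs hR hL0 hL k) hk).trans_eq ?_
  rw [mul_pow, Real.sq_sqrt zero_le_two]
  ring

lemma tendsto (hx : IsCCCP f h X₀ x) (hg : GConvex φ) (hdc : IsDC φ f h) (hX₀ : X₀ ∈ PD d)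
    (hXs : IsMinimizer φ Xs) (hR : ∀ Y ∈ sublevel φ X₀, riemDist Y Xs ≤ R) (hL0 : 0 ≤ L)
    (hL : LipschitzGradOn h L (convexHull ℝ (sublevel φ X₀))) :
    Tendsto (fun k => φ (x k)) atTop (𝓝 (φ Xs)) := by
  refine tendsto_sub_nhds_zero_iff.1 (squeeze_zero' ?_ ?_ (tendsto_const_div_natCast_add
    (2 * L * (Real.sqrt 2 * speedBound Xs R) ^ 2) 2))
  · exact Eventually.of_forall fun k => sub_nonneg.2 (hXs.2 _ (hx.mem_sublevel hdc hX₀ k).1)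
  · filter_upwards [eventually_ge_atTop 1] with k hk using hx.sub_le_div hg hdc hX₀ hXs hR hL0 hL hk

end IsCCCP

theorem cccp_convergence (hg : GConvex φ) (hdc : IsDC φ f h) (hX₀ : X₀ ∈ PD d)
    (hbdd : ∃ R : ℝ, ∀ Y ∈ sublevel φ X₀, riemDist Y X₀ ≤ R) :
    (∃ Xs, IsMinimizer φ Xs) ∧ (∃ x, IsCCCP f h X₀ x) ∧
      (∃ L : ℝ, 0 ≤ L ∧ LipschitzGradOn h L (convexHull ℝ (sublevel φ X₀))) ∧
      ∀ x : ℕ → Mat d, IsCCCP f h X₀ x →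
        (∀ (Xs : Mat d) (R L : ℝ), IsMinimizer φ Xs →
          (∀ Y ∈ sublevel φ X₀, riemDist Y Xs ≤ R) → 0 ≤ L →
          LipschitzGradOn h L (convexHull ℝ (sublevel φ X₀)) →
          ∀ k : ℕ, 1 ≤ k →
            φ (x k) - φ Xs ≤ 2 * L * (Real.sqrt 2 * speedBound Xs R) ^ 2 / (k + 2)) ∧
        (∀ ε : ℝ, 0 < ε → ∀ᶠ k in atTop, ∃ Y, IsMinimizer φ Y ∧ riemDist (x k) Y < ε) := by
  obtain ⟨R₀, hR₀⟩ := hbdd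
  have hexp : Real.exp (-R₀) • X₀ ∈ PD d := smul_mem_PD hX₀ (Real.exp_pos _)
  have hsub : sublevel φ X₀ ⊆ Set.Icc (Real.exp (-R₀) • X₀) (Real.exp R₀ • X₀) := fun Y hY =>
    mem_Icc_of_riemDist_le hY.1 hX₀ (hR₀ Y hY)
  have hS := isCompact_sublevel hdc.continuousOn hexp hsub
  have hSP : sublevel φ X₀ ⊆ PD d := fun X hX => hX.1
  obtain ⟨Xs, hXs⟩ := exists_isMinimizer hdc.continuousOn hS hSP
    (⟨hX₀, le_rfl⟩ : X₀ ∈ sublevel φ X₀) fun Y hY hle => ⟨hY, hle⟩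
  obtain ⟨L, hL0, hL⟩ :
      ∃ L : ℝ, 0 ≤ L ∧ LipschitzGradOn h L (convexHull ℝ (sublevel φ X₀)) := by
    obtain ⟨L, hL0, hL⟩ :=
      hdc.smooth_h.exists_lipschitzGradOn (isCompact_Icc_matrix _ _) (Icc_subset_PD hexp)
    have hhull := convexHull_min hsub (convex_Icc (𝕜 := ℝ) _ _)
    exact ⟨L, hL0, fun X hX Y hY => hL X (hhull hX) Y (hhull hY)⟩
  obtain ⟨R, hR⟩ := exists_riemDist_le_of_isCompact hS hSP hXs.1
  refine ⟨⟨Xs, hXs⟩, hdc.exists_isCCCP hX₀ hS, ⟨L, hL0, hL⟩, fun x hx => ⟨?_, fun ε hε => ?_⟩⟩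
  · exact fun Xs R L hXs hR hL0 hL k hk => hx.sub_le_div hg hdc hX₀ hXs hR hL0 hL hk
  · exact hXs.eventually_riemDist_lt hdc.continuousOn hS hSP (hx.mem_sublevel hdc hX₀)
      (hx.tendsto hg hdc hX₀ hXs hR hL0 hL) hε

end CCCP

/-! ### The decomposition of the regularized likelihood -/

section Calculus

variable {d : ℕ} {S T X Y W : Mat d} {v : Fin d → ℝ}

lemma add_mem_PD (hX : X ∈ PD d) (hT : T ∈ PD d) : X + T ∈ PD d := hX.add hT

lemma inv_mem_PD (hX : X ∈ PD d) : X⁻¹ ∈ PD d := hX.inv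

lemma det_pos_of_mem_PD (hX : X ∈ PD d) : 0 < X.det := hX.det_pos

lemma inv_mul_cancel_of_mem_PD (hX : X ∈ PD d) : X⁻¹ * X = 1 :=
  Matrix.nonsing_inv_mul X (det_pos_of_mem_PD hX).ne'.isUnit

lemma mul_inv_cancel_of_mem_PD (hX : X ∈ PD d) : X * X⁻¹ = 1 :=
  Matrix.mul_nonsing_inv X (det_pos_of_mem_PD hX).ne'.isUnit

lemma log_det_mul (hX : X ∈ PD d) (hT : T ∈ PD d) :
    Real.log (X * T).det = Real.log X.det + Real.log T.det := by
  rw [Matrix.det_mul, Real.log_mul (det_pos_of_mem_PD hX).ne' (det_pos_of_mem_PD hT).ne']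

lemma log_det_smul (hX : X ∈ PD d) {c : ℝ} (hc : 0 < c) :
    Real.log (c • X).det = d * Real.log c + Real.log X.det := by
  rw [Matrix.det_smul, Fintype.card_fin, Real.log_mul (pow_pos hc d).ne'
    (det_pos_of_mem_PD hX).ne', Real.log_pow]

lemma log_det_diagCongr (hW : IsUnit W) (hv : ∀ i, 0 < v i) :
    Real.log (diagCongr W v).det = Real.log (W.det ^ 2) + ∑ i, Real.log (v i) := by
  have hdet : W.det ^ 2 ≠ 0 := pow_ne_zero 2 ((Matrix.isUnit_iff_isUnit_det W).1 hW).ne_zero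
  rw [det_diagCongr, Real.log_mul hdet (Finset.prod_ne_zero_iff.2 fun i _ => (hv i).ne'),
    Real.log_prod fun i _ => (hv i).ne']

lemma isSubgradient_neg_log_det :
    IsSubgradient (fun X : Mat d => -Real.log X.det) fun X => -X⁻¹ where
  isSymm X hX := (isSymm_of_mem_PD (inv_mem_PD hX)).neg
  add_le X hX Y hY := by
    obtain ⟨W, v, hW, hv, hWX, hWY, -, -⟩ := exists_congruence hX hY
    have hWXW : Wᵀ * X⁻¹ * W = 1 := by
      have hWt : IsUnit Wᵀ.det := by
        rw [Matrix.det_transpose]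
        exact (Matrix.isUnit_iff_isUnit_det W).1 hW
      rw [hWX, diagCongr_one_right, Matrix.mul_inv_rev, ← Matrix.mul_assoc,
        Matrix.mul_nonsing_inv _ hWt, Matrix.one_mul,
        Matrix.nonsing_inv_mul _ ((Matrix.isUnit_iff_isUnit_det W).1 hW)]
    have hinner : frobInner X⁻¹ (Y - X) = ∑ i, (v i - 1) := by
      rw [frobInner, (isSymm_of_mem_PD (inv_mem_PD hX)).eq, hWY]
      nth_rw 2 [hWX]
      rw [← map_sub, trace_mul_diagCongr, hWXW]
      simp
    have hlogX : Real.log X.det = Real.log (W.det ^ 2) := by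
      rw [hWX, log_det_diagCongr (v := 1) hW fun _ => one_pos]
      simp
    have hlogY : Real.log Y.det = Real.log (W.det ^ 2) + ∑ i, Real.log (v i) := by
      rw [hWY, log_det_diagCongr hW hv]
    have hsum : ∑ i, Real.log (v i) ≤ ∑ i, (v i - 1) :=
      Finset.sum_le_sum fun i _ => Real.log_le_sub_one_of_pos (hv i)
    rw [frobInner_neg_left, hinner, hlogX, hlogY]
    linarith

lemma log_det_mono (hX : X ∈ PD d) (hXY : X ≤ Y) : Real.log X.det ≤ Real.log Y.det := by
  have hY : Y ∈ PD d := posDef_of_le hX hXY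
  have hle := isSubgradient_neg_log_det.add_le Y hY X hX
  have htrace := trace_mul_nonneg (nonneg_of_mem_PD (inv_mem_PD hY)) (sub_nonneg.2 hXY)
  rw [frobInner_neg_left, ← neg_sub Y X, frobInner_neg_right, frobInner,
    (isSymm_of_mem_PD (inv_mem_PD hY)).eq] at hle
  linarith

lemma isSymm_inv_mul_mul_inv (hS : S.IsSymm) (hX : X ∈ PD d) : (X⁻¹ * S * X⁻¹).IsSymm := by
  rw [Matrix.IsSymm, Matrix.transpose_mul, Matrix.transpose_mul,
    (isSymm_of_mem_PD (inv_mem_PD hX)).eq, hS.eq, Matrix.mul_assoc]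

lemma isSubgradient_trace_mul_inv (hS : S.PosSemidef) :
    IsSubgradient (fun X : Mat d => (S * X⁻¹).trace) fun X => -(X⁻¹ * S * X⁻¹) where
  isSymm X hX := (isSymm_inv_mul_mul_inv (S := S) hS.isHermitian hX).neg
  add_le X hX Y hY := by
    have hsquare : 0 ≤ (X⁻¹ - Y⁻¹) * Y * (X⁻¹ - Y⁻¹) := by
      have hsymm : (X⁻¹ - Y⁻¹).IsSymm :=
        (isSymm_of_mem_PD (inv_mem_PD hX)).sub (isSymm_of_mem_PD (inv_mem_PD hY))
      simpa only [Matrix.nonneg_iff_posSemidef, Matrix.conjTranspose_eq_transpose_of_trivial,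
        hsymm.eq] using
        (Matrix.nonneg_iff_posSemidef.1 (nonneg_of_mem_PD hY)).mul_mul_conjTranspose_same
          (X⁻¹ - Y⁻¹)
    have hexpand : (X⁻¹ - Y⁻¹) * Y * (X⁻¹ - Y⁻¹) = X⁻¹ * (Y - X) * X⁻¹ - X⁻¹ + Y⁻¹ := by
      simp only [Matrix.sub_mul, Matrix.mul_sub, inv_mul_cancel_of_mem_PD hX,
        inv_mul_cancel_of_mem_PD hY, Matrix.one_mul, Matrix.mul_assoc,
        mul_inv_cancel_of_mem_PD hY, Matrix.mul_one]
      abel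
    have hSsymm : S.IsSymm := hS.isHermitian
    have hinner : frobInner (X⁻¹ * S * X⁻¹) (Y - X) = (S * (X⁻¹ * (Y - X) * X⁻¹)).trace := by
      rw [frobInner, (isSymm_inv_mul_mul_inv hSsymm hX).eq, Matrix.mul_assoc,
        Matrix.mul_assoc, Matrix.trace_mul_comm]
      simp only [Matrix.mul_assoc]
    have htrace := trace_mul_nonneg (Matrix.nonneg_iff_posSemidef.2 hS) hsquare
    rw [hexpand, Matrix.mul_add, Matrix.mul_sub, Matrix.trace_add, Matrix.trace_sub] at htrace
    rw [frobInner_neg_left, hinner]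
    linarith

lemma contDiffOn_inv_PD : ContDiffOn ℝ 1 (fun X : Mat d => X⁻¹) (PD d) := by
  intro X hX
  obtain ⟨u, rfl⟩ := Matrix.PosDef.isUnit hX
  have hinverse : (fun X : Mat d => X⁻¹) = Ring.inverse :=
    funext fun X => Matrix.nonsing_inv_eq_ringInverse X
  rw [hinverse]
  exact (contDiffAt_ringInverse ℝ u).contDiffWithinAt

end Calculus

section OptLik

variable {d : ℕ} {S T X : Mat d} {β : ℝ}

/-- The gradient of `optLikF S T β`, which does not depend on `T`. The inner loop steps along its
difference with `optLikGradH`. -/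
def optLikGradF (S : Mat d) (β : ℝ) (X : Mat d) : Mat d :=
  -(X⁻¹ * S * X⁻¹) - (β / 2) • X⁻¹

/-- The gradient of `optLikH T β`, held fixed at the outer iterate during the inner loop. -/
def optLikGradH (T : Mat d) (β : ℝ) (X : Mat d) : Mat d :=
  -X⁻¹ - β • (X + T)⁻¹

lemma isSubgradient_optLikF (hS : S.PosSemidef) (hT : T ∈ PD d) (hβ : 0 ≤ β) :
    IsSubgradient (optLikF S T β) (optLikGradF S β) := by
  have hsum := ((isSubgradient_trace_mul_inv hS).add (isSubgradient_neg_log_det.smul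
    (by positivity : 0 ≤ β / 2))).congr_add_const (-(β / 2 * Real.log T.det)) (h' := optLikF S T β)
    fun X hX => by
      rw [optLikF, log_det_mul hX hT]
      ring
  simp only [smul_neg, ← sub_eq_add_neg] at hsum
  exact hsum

lemma isSubgradient_optLikH (hT : T ∈ PD d) (hβ : 0 ≤ β) :
    IsSubgradient (optLikH T β) (optLikGradH T β) := by
  have hsum := (isSubgradient_neg_log_det.add ((isSubgradient_neg_log_det.comp_add_right hT).smul
    hβ)).congr_add_const (-(β * (d * Real.log (1 / 2)))) (h' := optLikH T β) fun X hX => by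
      rw [optLikH, log_det_smul (add_mem_PD hX hT) one_half_pos]
      ring
  simp only [smul_neg, ← sub_eq_add_neg] at hsum
  exact hsum

lemma locallyLipschitzOn_optLikGradF (S : Mat d) (β : ℝ) :
    LocallyLipschitzOn (PD d) (optLikGradF S β) := by
  have hinv := contDiffOn_inv_PD (d := d)
  have hdiff : ContDiffOn ℝ 1 (optLikGradF S β) (PD d) := by
    unfold optLikGradF
    fun_prop
  exact hdiff.locallyLipschitzOn convex_PD

lemma locallyLipschitzOn_optLikGradH (hT : T ∈ PD d) (β : ℝ) :
    LocallyLipschitzOn (PD d) (optLikGradH T β) := by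
  have hinv := contDiffOn_inv_PD (d := d)
  have hinv_add : ContDiffOn ℝ 1 (fun X : Mat d => (X + T)⁻¹) (PD d) :=
    hinv.comp (by fun_prop) fun X hX => add_mem_PD hX hT
  have hdiff : ContDiffOn ℝ 1 (optLikGradH T β) (PD d) := by
    unfold optLikGradH
    fun_prop
  exact hdiff.locallyLipschitzOn convex_PD

lemma optLik_eq_sub (S T : Mat d) (β : ℝ) (X : Mat d) :
    optLik S T β X = optLikF S T β X - optLikH T β X := by
  simp only [optLik, regularized, gaussNLL, sDiv, optLikF, optLikH]
  ring

lemma isDC_optLik (hS : S.PosSemidef) (hT : T ∈ PD d) (hβ : 0 ≤ β) :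
    IsDC (optLik S T β) (optLikF S T β) (optLikH T β) where
  convex_f := (isSubgradient_optLikF hS hT hβ).convexOn
  convex_h := (isSubgradient_optLikH hT hβ).convexOn
  smooth_h := (isSubgradient_optLikH hT hβ).smoothOnPD (locallyLipschitzOn_optLikGradH hT β)
  eq_sub X _ := optLik_eq_sub S T β X

lemma optLik_eq (hX : X ∈ PD d) (hT : T ∈ PD d) :
    optLik S T β X = (S * X⁻¹).trace + (1 - β / 2) * Real.log X.det +
      β * Real.log (X + T).det + (β * (d * Real.log (1 / 2)) - β / 2 * Real.log T.det) := by
  simp only [optLik, regularized, gaussNLL, sDiv]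
  rw [log_det_mul hX hT, log_det_smul (add_mem_PD hX hT) one_half_pos]
  ring

end OptLik

/-! ### Geodesic convexity of the regularized likelihood -/

section LogSumExp

variable {ι E : Type*} [Fintype ι] [AddCommGroup E] [Module ℝ E]

lemma sum_mul_exp_add_lt_one {a u v : ι → ℝ} (ha : ∀ i, 0 < a i)
    (hu : ∑ i, a i * Real.exp (u i) = 1) (hv : ∑ i, a i * Real.exp (v i) = 1) (huv : u ≠ v)
    {s t : ℝ} (hs : 0 < s) (ht : 0 < t) (hst : s + t = 1) :
    ∑ i, a i * Real.exp (s * u i + t * v i) < 1 := by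
  have hle (i : ι) : Real.exp (s * u i + t * v i) ≤ s * Real.exp (u i) + t * Real.exp (v i) :=
    convexOn_exp.2 trivial trivial hs.le ht.le hst
  obtain ⟨j, hj⟩ := Function.ne_iff.1 huv
  calc ∑ i, a i * Real.exp (s * u i + t * v i)
      < ∑ i, a i * (s * Real.exp (u i) + t * Real.exp (v i)) :=
        Finset.sum_lt_sum (fun i _ => mul_le_mul_of_nonneg_left (hle i) (ha i).le)
          ⟨j, Finset.mem_univ j, mul_lt_mul_of_pos_left
            (strictConvexOn_exp.2 trivial trivial hj hs ht hst) (ha j)⟩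
    _ = s * ∑ i, a i * Real.exp (u i) + t * ∑ i, a i * Real.exp (v i) := by
        rw [Finset.mul_sum, Finset.mul_sum, ← Finset.sum_add_distrib]
        exact Finset.sum_congr rfl fun i _ => by ring
    _ = 1 := by rw [hu, hv, mul_one, mul_one, hst]

lemma strictConvexOn_log_sum_mul_exp {a : ι → ℝ} (ha : ∀ i, 0 < a i) {ℓ : ι → E →ₗ[ℝ] ℝ}
    (hℓ : ∀ z, (∀ i j, ℓ i z = ℓ j z) → z = 0) :
    StrictConvexOn ℝ Set.univ fun x => Real.log (∑ i, a i * Real.exp (ℓ i x)) := by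
  refine ⟨convex_univ, fun x _ y _ hxy s t hs ht hst => ?_⟩
  obtain ⟨i₁, i₂, hi⟩ : ∃ i₁ i₂, ℓ i₁ (x - y) ≠ ℓ i₂ (x - y) := by
    by_contra! hconst
    exact sub_ne_zero.2 hxy (hℓ (x - y) hconst)
  have hpos (z : E) : 0 < ∑ i, a i * Real.exp (ℓ i z) :=
    Finset.sum_pos (fun i _ => mul_pos (ha i) (Real.exp_pos _)) ⟨i₁, Finset.mem_univ i₁⟩
  set p : E → ℝ := fun z => Real.log (∑ i, a i * Real.exp (ℓ i z)) with hp
  have hnormalized (z : E) : ∑ i, a i * Real.exp (ℓ i z - p z) = 1 := by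
    simp only [Real.exp_sub, mul_div_assoc', ← Finset.sum_div, hp, Real.exp_log (hpos z),
      div_self (hpos z).ne']
  have hne : (fun i => ℓ i x - p x) ≠ fun i => ℓ i y - p y := fun heq => hi <| by
    rw [map_sub, map_sub]
    linarith [congrFun heq i₁, congrFun heq i₂]
  have hsum : ∑ i, a i * Real.exp (ℓ i (s • x + t • y) - (s * p x + t * p y)) < 1 := by
    convert sum_mul_exp_add_lt_one ha (hnormalized x) (hnormalized y) hne hs ht hst using 4
    rw [map_add, map_smul, map_smul, smul_eq_mul, smul_eq_mul]
    ring
  simp only [Real.exp_sub, mul_div_assoc', ← Finset.sum_div] at hsum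
  rw [div_lt_one (Real.exp_pos _)] at hsum
  exact (Real.log_lt_iff_lt_exp (hpos _)).2 hsum

end LogSumExp

section PrincipalMinors

variable {n R : Type*} [Fintype n] [DecidableEq n] [CommRing R]

lemma det_add_diagonal (N : Matrix n n R) (x : n → R) :
    (N + Matrix.diagonal x).det =
      ∑ s : Finset n, (N.submatrix ((↑) : s → n) (↑)).det * ∏ i ∈ sᶜ, x i := by
  have hexpand : (N + Matrix.diagonal x).det =
      ∑ s : Finset n, (Matrix.of (s.piecewise N.row (Matrix.diagonal x).row)).det :=
    Matrix.detRowAlternating.map_add_univ N.row (Matrix.diagonal x).row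
  rw [hexpand]
  refine Finset.sum_congr rfl fun s _ => ?_
  have hrows : Matrix.of (s.piecewise N.row (Matrix.diagonal x).row) =
      Matrix.of fun i j => s.piecewise (1 : n → R) x i *
        Matrix.of (s.piecewise N.row (1 : Matrix n n R).row) i j := by
    ext i j
    by_cases hi : i ∈ s
    · simp [hi]
    · simp [hi, Matrix.diagonal_apply, Matrix.one_apply]
  rw [hrows, Matrix.det_mul_column, Matrix.det_piecewise_one_eq_submatrix_det, mul_comm,
    Finset.prod_piecewise]
  simp [Finset.compl_eq_univ_sdiff]

end PrincipalMinors

section GConvexity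

variable {d : ℕ} {S T W : Mat d} {β : ℝ}

lemma det_diagCongr_add (hW : IsUnit W) (T : Mat d) (v : Fin d → ℝ) :
    (diagCongr W v + T).det = ∑ s : Finset (Fin d),
      W.det ^ 2 * ((W⁻¹ * T * (W⁻¹)ᵀ).submatrix ((↑) : s → Fin d) (↑)).det * ∏ i ∈ sᶜ, v i := by
  have hWdet : IsUnit W.det := (Matrix.isUnit_iff_isUnit_det W).1 hW
  have hT : W * (W⁻¹ * T * (W⁻¹)ᵀ) * Wᵀ = T := by
    rw [← Matrix.mul_assoc, ← Matrix.mul_assoc, Matrix.mul_nonsing_inv _ hWdet, Matrix.one_mul,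
      Matrix.mul_assoc, ← Matrix.transpose_mul, Matrix.mul_nonsing_inv _ hWdet,
      Matrix.transpose_one, Matrix.mul_one]
  have hcongr : diagCongr W v + T =
      W * (W⁻¹ * T * (W⁻¹)ᵀ + Matrix.diagonal v) * Wᵀ := by
    rw [Matrix.mul_add, Matrix.add_mul, hT, diagCongr_apply, add_comm]
  rw [hcongr, Matrix.det_mul, Matrix.det_mul, Matrix.det_transpose, det_add_diagonal,
    mul_right_comm, ← sq, Finset.mul_sum]
  simp only [mul_assoc]

lemma strictConvexOn_log_det_diagCongr_exp_add (hW : IsUnit W) (hT : T ∈ PD d) :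
    StrictConvexOn ℝ Set.univ fun y : Fin d → ℝ =>
      Real.log (diagCongr W (fun i => Real.exp (y i)) + T).det := by
  have hcongr : (W⁻¹ * T * (W⁻¹)ᵀ).PosDef :=
    (Matrix.IsUnit.posDef_star_right_conjugate_iff (Matrix.isUnit_nonsing_inv_iff.2 hW)).2 hT
  have hminor (s : Finset (Fin d)) :
      0 < W.det ^ 2 * ((W⁻¹ * T * (W⁻¹)ᵀ).submatrix ((↑) : s → Fin d) (↑)).det :=
    mul_pos (sq_pos_of_ne_zero ((Matrix.isUnit_iff_isUnit_det W).1 hW).ne_zero)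
      (hcongr.submatrix Subtype.val_injective).det_pos
  have hexp (s : Finset (Fin d)) (y : Fin d → ℝ) : ∏ i ∈ sᶜ, Real.exp (y i) =
      Real.exp ((∑ i ∈ sᶜ, LinearMap.proj (R := ℝ) (φ := fun _ => ℝ) i) y) := by
    rw [LinearMap.sum_apply, Real.exp_sum]
    rfl
  simp only [det_diagCongr_add hW, hexp]
  refine strictConvexOn_log_sum_mul_exp hminor fun z hz => funext fun i => ?_
  simpa using hz {i}ᶜ Finset.univ

lemma convexOn_trace_mul_inv_diagCongr_exp (hS : S.PosSemidef) (W : Mat d) :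
    ConvexOn ℝ Set.univ fun y : Fin d → ℝ =>
      (S * (diagCongr W fun i => Real.exp (y i))⁻¹).trace := by
  have hcongr : (W⁻¹ * S * (W⁻¹)ᵀ).PosSemidef := hS.mul_mul_conjTranspose_same W⁻¹
  have hterm (i : Fin d) : ConvexOn ℝ Set.univ fun y : Fin d → ℝ =>
      (W⁻¹ * S * (W⁻¹)ᵀ) i i * Real.exp (-y i) :=
    (convexOn_exp.comp_linearMap (-LinearMap.proj (R := ℝ) (φ := fun _ => ℝ) i)).smul
      hcongr.diag_nonneg
  have htrace (y : Fin d → ℝ) : (S * (diagCongr W fun i => Real.exp (y i))⁻¹).trace =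
      ∑ i, (W⁻¹ * S * (W⁻¹)ᵀ) i i * Real.exp (-y i) := by
    rw [inv_diagCongr W fun i => (Real.exp_pos (y i)).ne', trace_mul_diagCongr,
      Matrix.transpose_transpose]
    simp only [Pi.inv_apply, Real.exp_neg]
  refine ⟨convex_univ, fun x hx y hy s t hs ht hst => ?_⟩
  simp only [htrace, Finset.smul_sum, ← Finset.sum_add_distrib]
  exact Finset.sum_le_sum fun i _ => (hterm i).2 hx hy hs ht hst

lemma strictConvexOn_optLik_diagCongr_exp (hW : IsUnit W) (hS : S.PosSemidef) (hT : T ∈ PD d)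
    (hβ : 0 < β) :
    StrictConvexOn ℝ Set.univ fun y : Fin d → ℝ =>
      optLik S T β (diagCongr W fun i => Real.exp (y i)) := by
  have hlog (y : Fin d → ℝ) : Real.log (diagCongr W fun i => Real.exp (y i)).det =
      Real.log (W.det ^ 2) + ∑ i, y i := by
    rw [log_det_diagCongr hW fun i => Real.exp_pos (y i)]
    simp only [Real.log_exp]
  have hlinear : ConvexOn ℝ Set.univ fun y : Fin d → ℝ => (1 - β / 2) * ∑ i, y i := by
    refine ⟨convex_univ, fun x _ y _ s t _ _ _ => le_of_eq ?_⟩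
    simp only [Pi.add_apply, Pi.smul_apply, smul_eq_mul, Finset.sum_add_distrib, ← Finset.mul_sum]
    ring
  have hstrict : StrictConvexOn ℝ Set.univ fun y : Fin d → ℝ =>
      β * Real.log (diagCongr W (fun i => Real.exp (y i)) + T).det := by
    refine ⟨convex_univ, fun x hx y hy hxy s t hs ht hst => ?_⟩
    have hlt := mul_lt_mul_of_pos_left
      ((strictConvexOn_log_det_diagCongr_exp_add hW hT).2 hx hy hxy hs ht hst) hβ
    simp only [smul_eq_mul, mul_add, mul_left_comm β] at hlt ⊢
    exact hlt
  have hsum := (((convexOn_trace_mul_inv_diagCongr_exp hS W).add hlinear).add_strictConvexOn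
    hstrict).add_const ((1 - β / 2) * Real.log (W.det ^ 2) +
      (β * (d * Real.log (1 / 2)) - β / 2 * Real.log T.det))
  refine hsum.congr fun y _ => ?_
  have hmem : (diagCongr W fun i => Real.exp (y i)) ∈ PD d :=
    (posDef_diagCongr_iff hW).2 fun i => Real.exp_pos (y i)
  rw [optLik_eq hmem hT, hlog]
  simp only [Pi.add_apply]
  ring

lemma gConvex_optLik (hS : S.PosSemidef) (hT : T ∈ PD d) (hβ : 0 < β) :
    GConvex (optLik S T β) := by
  intro A hA B hB
  obtain ⟨W, v, hW, hv, -, -, hgeodesic, -⟩ := exists_congruence hA hB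
  have hline (t : ℝ) : geodesic A B t =
      diagCongr W fun i => Real.exp ((t • fun i => Real.log (v i)) i) := by
    rw [hgeodesic]
    congr 1
    funext i
    rw [Real.rpow_def_of_pos (hv i), Pi.smul_apply, smul_eq_mul, mul_comm]
  simp only [hline]
  exact ((strictConvexOn_optLik_diagCongr_exp hW hS hT hβ).convexOn.comp_linearMap
    (LinearMap.toSpanSingleton ℝ _ fun i => Real.log (v i))).subset
    (Set.subset_univ _) (convex_Icc 0 1)

lemma IsMinimizer.eq_of_optLik {A B : Mat d} (hA : IsMinimizer (optLik S T β) A)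
    (hB : IsMinimizer (optLik S T β) B) (hS : S.PosSemidef) (hT : T ∈ PD d) (hβ : 0 < β) :
    A = B := by
  obtain ⟨W, v, hW, hv, hWA, hWB, -, -⟩ := exists_congruence hA.1 hB.1
  have hexp_log : (fun i => Real.exp (Real.log (v i))) = v :=
    funext fun i => Real.exp_log (hv i)
  have hminOn {p : Fin d → ℝ}
      (hp : IsMinimizer (optLik S T β) (diagCongr W fun i => Real.exp (p i))) :
      IsMinOn (fun y : Fin d → ℝ => optLik S T β (diagCongr W fun i => Real.exp (y i)))
        Set.univ p :=
    fun y _ => hp.2 _ ((posDef_diagCongr_iff hW).2 fun i => Real.exp_pos (y i))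
  have hzero : (0 : Fin d → ℝ) = fun i => Real.log (v i) := by
    refine (strictConvexOn_optLik_diagCongr_exp hW hS hT hβ).eq_of_isMinOn (hminOn ?_) (hminOn ?_)
      trivial trivial
    · simpa only [Pi.zero_apply, Real.exp_zero, ← Pi.one_def, ← hWA] using hA
    · rwa [hexp_log, ← hWB]
  have hlog (i : Fin d) : Real.log (v i) = 0 := (congrFun hzero i).symm
  rw [hWA, hWB, ← hexp_log]
  simp only [hlog, Real.exp_zero, Pi.one_def]

end GConvexity

section Coercivity

variable {d : ℕ} {S T U : Mat d} {β σ τ : ℝ}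

lemma exists_mul_abs_sub_le (hσ : 0 ≤ σ) (hτ : 0 < τ) (hβ : 0 < β) (h : 0 < σ ∨ 2 < β) :
    ∃ c C : ℝ, 0 < c ∧ ∀ z : ℝ, c * |z| - C ≤
      σ * Real.exp (-z) + (1 - β / 2) * z + β * Real.log (Real.exp z + τ) := by
  obtain ⟨c, C, hc, hneg⟩ : ∃ c C : ℝ, 0 < c ∧
      ∀ z ≤ 0, c * -z - C ≤ σ * Real.exp (-z) + (1 - β / 2) * z := by
    rcases h with hσ | hβ2
    · refine ⟨1, -(2 * (1 + Real.log (σ / 2))), one_pos, fun z hz => ?_⟩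
      have hexp : Real.log (σ / 2) - z + 1 ≤ σ / 2 * Real.exp (-z) := by
        have hle := Real.add_one_le_exp (Real.log (σ / 2) - z)
        rwa [sub_eq_add_neg, Real.exp_add, Real.exp_log (half_pos hσ), ← sub_eq_add_neg] at hle
      linarith [mul_nonneg hβ.le (neg_nonneg.2 hz)]
    · exact ⟨β / 2 - 1, 0, by linarith, fun z _ => by
        linarith [mul_nonneg hσ (Real.exp_pos (-z)).le]⟩
  refine ⟨min c 1, |C| + |β * Real.log τ|, lt_min hc one_pos, fun z => ?_⟩
  rcases le_total 0 z with hz | hz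
  · have hlog : z ≤ Real.log (Real.exp z + τ) :=
      (Real.le_log_iff_exp_le (by positivity)).2 (by linarith)
    rw [abs_of_nonneg hz]
    nlinarith [mul_le_mul_of_nonneg_right (min_le_right c 1) hz, abs_nonneg C,
      abs_nonneg (β * Real.log τ), mul_nonneg hσ (Real.exp_pos (-z)).le, mul_nonneg hβ.le hz]
  · have hlog : β * Real.log τ ≤ β * Real.log (Real.exp z + τ) :=
      mul_le_mul_of_nonneg_left (Real.log_le_log hτ (by linarith [Real.exp_pos z])) hβ.le
    rw [abs_of_nonpos hz]
    linarith [hneg z hz, mul_le_mul_of_nonneg_right (min_le_left c 1) (neg_nonneg.2 hz),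
      le_abs_self C, neg_abs_le (β * Real.log τ)]

lemma sum_le_optLik_diagCongr_exp (hS : σ • 1 ≤ S) (hτ : 0 < τ) (hT : τ • 1 ≤ T) (hβ : 0 ≤ β)
    (hU : U ∈ Matrix.orthogonalGroup (Fin d) ℝ) (z : Fin d → ℝ) :
    ∑ i, (σ * Real.exp (-z i) + (1 - β / 2) * z i + β * Real.log (Real.exp (z i) + τ)) +
      (β * (d * Real.log (1 / 2)) - β / 2 * Real.log T.det) ≤
      optLik S T β (diagCongr U fun i => Real.exp (z i)) := by
  have hX : (diagCongr U fun i => Real.exp (z i)) ∈ PD d :=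
    (posDef_diagCongr_iff (isUnit_of_mem_orthogonalGroup hU)).2 fun i => Real.exp_pos (z i)
  have hτPD : τ • (1 : Mat d) ∈ PD d := smul_mem_PD Matrix.PosDef.one hτ
  have htrace : σ * ∑ i, Real.exp (-z i) ≤
      (S * (diagCongr U fun i => Real.exp (z i))⁻¹).trace := by
    have hnonneg := trace_mul_nonneg (sub_nonneg.2 hS) (nonneg_of_mem_PD (inv_mem_PD hX))
    rw [Matrix.sub_mul, Matrix.trace_sub, Matrix.smul_mul, Matrix.one_mul, Matrix.trace_smul,
      sub_nonneg] at hnonneg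
    have htrace_inv : (diagCongr U fun i => Real.exp (z i))⁻¹.trace = ∑ i, Real.exp (-z i) := by
      rw [inv_diagCongr_of_mem_orthogonalGroup hU fun i => (Real.exp_pos (z i)).ne',
        trace_diagCongr_of_mem_orthogonalGroup hU]
      simp only [Pi.inv_apply, Real.exp_neg]
    rwa [htrace_inv, smul_eq_mul] at hnonneg
  have hlog : ∑ i, Real.log (Real.exp (z i) + τ) ≤
      Real.log ((diagCongr U fun i => Real.exp (z i)) + T).det := by
    have hadd : (diagCongr U fun i => Real.exp (z i)) + τ • 1 =
        diagCongr U fun i => Real.exp (z i) + τ := by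
      rw [← diagCongr_smul_one hU, ← map_add]
      congr 1
      ext i
      simp
    rw [← Real.log_prod fun i _ => (add_pos (Real.exp_pos (z i)) hτ).ne',
      ← det_diagCongr_of_mem_orthogonalGroup hU, ← hadd]
    exact log_det_mono (add_mem_PD hX hτPD) (add_le_add_right hT _)
  rw [optLik_eq hX (posDef_of_le hτPD hT), det_diagCongr_of_mem_orthogonalGroup hU,
    Real.log_prod fun i _ => (Real.exp_pos (z i)).ne']
  simp only [Real.log_exp, Finset.sum_add_distrib, ← Finset.mul_sum]
  linarith [mul_le_mul_of_nonneg_left hlog hβ]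

lemma exists_Icc_of_optLik_le (hS : S.PosSemidef) (hT : T ∈ PD d) (hβ : 0 < β)
    (h : S.PosDef ∨ 2 < β) (M : ℝ) :
    ∃ A ∈ PD d, ∃ B, ∀ X ∈ PD d, optLik S T β X ≤ M → X ∈ Set.Icc A B := by
  obtain ⟨τ, hτ, hTτ⟩ := exists_pos_smul_one_le hT
  obtain ⟨σ, hσ, hSσ, hor⟩ : ∃ σ : ℝ, 0 ≤ σ ∧ σ • 1 ≤ S ∧ (0 < σ ∨ 2 < β) := by
    rcases h with hSd | hβ2
    · obtain ⟨σ, hσ, hSσ⟩ := exists_pos_smul_one_le hSd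
      exact ⟨σ, hσ.le, hSσ, Or.inl hσ⟩
    · exact ⟨0, le_rfl, by simpa using Matrix.nonneg_iff_posSemidef.2 hS, Or.inr hβ2⟩
  obtain ⟨c, C, hc, hcoercive⟩ := exists_mul_abs_sub_le hσ hτ hβ hor
  set κ : ℝ := β * (d * Real.log (1 / 2)) - β / 2 * Real.log T.det
  set r : ℝ := (M - κ + d * C) / c
  refine ⟨Real.exp (-r) • 1, smul_mem_PD Matrix.PosDef.one (Real.exp_pos _), Real.exp r • 1,
    fun X hX hXM => ?_⟩
  obtain ⟨U, hU, v, rfl⟩ := exists_orthogonal_eq_diagCongr (Matrix.PosDef.isHermitian hX)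
  have hv := (posDef_diagCongr_iff (isUnit_of_mem_orthogonalGroup hU)).1 hX
  obtain ⟨z, rfl⟩ : ∃ z : Fin d → ℝ, v = fun i => Real.exp (z i) :=
    ⟨fun i => Real.log (v i), funext fun i => (Real.exp_log (hv i)).symm⟩
  have hsum : c * ∑ i, |z i| ≤ M - κ + d * C := by
    have hlower : ∑ i, (c * |z i| - C) ≤ _ := Finset.sum_le_sum fun i _ => hcoercive (z i)
    rw [Finset.sum_sub_distrib, ← Finset.mul_sum, Finset.sum_const, Finset.card_univ,
      Fintype.card_fin, nsmul_eq_mul] at hlower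
    have hupper : _ + κ ≤ M := (sum_le_optLik_diagCongr_exp hSσ hτ hTτ hβ.le hU z).trans hXM
    linarith
  have hbound (i : Fin d) : |z i| ≤ r := by
    exact (le_div_iff₀' hc).2 <|
      (mul_le_mul_of_nonneg_left (Finset.single_le_sum (fun i _ => abs_nonneg (z i))
      (Finset.mem_univ i)) hc.le).trans hsum
  constructor
  · rw [← diagCongr_smul_one hU]
    exact diagCongr_mono U fun i => by simpa using (abs_le.1 (hbound i)).1
  · rw [← diagCongr_smul_one hU]
    exact diagCongr_mono U fun i => by simpa using (abs_le.1 (hbound i)).2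

end Coercivity

/-! ### Gradient steps on the surrogate -/

section SurrogateDescent

variable {d : ℕ} {φ f h : Mat d → ℝ} {gf gh : Mat d → Mat d} {A B G X X₀ Xs Y : Mat d}
  {K : Set (Mat d)} {x : ℕ → Mat d} {η : ℕ → ℝ} {ηmax R : ℝ}

/- Along the geodesic from `A` to `B` g-convexity yields a decrease of at least `t * (φ A - φ B)`,
while the Euclidean first order decrease is at most `‖gf A - gh A‖ * ‖geodesic A B t - A‖`. -/
lemma sub_le_norm_subgradient_sub_mul (hg : GConvex φ) (hf : IsSubgradient f gf)
    (hh : IsSubgradient h gh) (hcont : ContinuousOn gh (PD d))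
    (hφ : ∀ X ∈ PD d, φ X = f X - h X) (hA : A ∈ PD d) (hB : B ∈ PD d) (hR : riemDist A B ≤ R) :
    φ A - φ B ≤ ‖gf A - gh A‖ * speedBound B R := by
  set γ := geodesic A B
  have hγ : ∀ t, γ t ∈ PD d := geodesic_mem hA hB
  have hnear : ∀ᶠ t in 𝓝[>] (0 : ℝ), t ∈ Set.Ioo (0 : ℝ) 1 := Ioo_mem_nhdsGT one_pos
  have hspeed : ∀ t ∈ Set.Ioo (0 : ℝ) 1, ‖γ t - A‖ ≤ t * speedBound B R := fun t ht =>
    norm_geodesic_sub_le hA hB hR ht.1.le ht.2.le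
  have hγA : Tendsto γ (𝓝[>] 0) (𝓝[PD d] A) := by
    refine tendsto_nhdsWithin_iff.2 ⟨?_, Eventually.of_forall hγ⟩
    refine tendsto_iff_norm_sub_tendsto_zero.2 (squeeze_zero' (Eventually.of_forall fun t =>
      norm_nonneg _) (hnear.mono hspeed) ?_)
    have hlin : Continuous fun t : ℝ => t * speedBound B R := by fun_prop
    simpa using (hlin.tendsto 0).mono_left nhdsWithin_le_nhds
  have hbound : ∀ᶠ t in 𝓝[>] (0 : ℝ), φ A - φ B ≤ ‖gf A - gh (γ t)‖ * speedBound B R := by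
    filter_upwards [hnear] with t ht
    have hconv : φ (γ t) ≤ (1 - t) * φ A + t * φ B := hg.geodesic_le hA hB ht.1.le ht.2.le
    have hinner := (neg_le_abs _).trans (abs_frobInner_le (gf A - gh (γ t)) (γ t - A))
    rw [frobInner_sub_left] at hinner
    rw [hφ _ (hγ t), hφ A hA] at hconv
    rw [hφ A hA]
    refine le_of_mul_le_mul_left ?_ ht.1
    calc t * (f A - h A - φ B) ≤ ‖gf A - gh (γ t)‖ * ‖γ t - A‖ := by
          linarith [hf.add_le A hA _ (hγ t), hh.sub_le hA (hγ t)]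
      _ ≤ ‖gf A - gh (γ t)‖ * (t * speedBound B R) := by gcongr; exact hspeed t ht
      _ = t * (‖gf A - gh (γ t)‖ * speedBound B R) := by ring
  exact ge_of_tendsto ((((hcont A hA).tendsto.comp hγA).const_sub (gf A)).norm.mul_const _) hbound

namespace IsSubgradient

lemma sub_le_linearized_sub (hh : IsSubgradient h gh) (hφ : ∀ X ∈ PD d, φ X = f X - h X)
    (hX : X ∈ PD d) (hY : Y ∈ PD d) :
    φ X - φ Y ≤ (f X - frobInner (gh Y) X) - (f Y - frobInner (gh Y) Y) := by
  have hle := hh.add_le Y hY X hX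
  rw [sub_eq_add_neg, frobInner_add_right, frobInner_neg_right] at hle
  rw [hφ X hX, hφ Y hY]
  linarith

lemma gradientStep_le (hf : IsSubgradient f gf) {c Λ : ℝ} (hX : X ∈ PD d)
    (hmem : X - c • (gf X - G) ∈ PD d) (hc : 0 ≤ c) (hcΛ : Λ * c ≤ 1 / 2)
    (hΛ : ‖gf (X - c • (gf X - G)) - gf X‖ ≤ Λ * ‖X - c • (gf X - G) - X‖) :
    f (X - c • (gf X - G)) - frobInner G (X - c • (gf X - G)) ≤
      f X - frobInner G X - c / 2 * ‖gf X - G‖ ^ 2 := by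
  set D := gf X - G with hD
  set Z := X - c • D with hZ
  have hconv := hf.sub_le hX hmem
  have hZX : Z - X = -(c • D) := by rw [hZ]; abel
  have hlip : -frobInner (gf Z - gf X) D ≤ 1 / 2 * ‖D‖ ^ 2 := by
    calc -frobInner (gf Z - gf X) D ≤ ‖gf Z - gf X‖ * ‖D‖ :=
          (neg_le_abs _).trans (abs_frobInner_le _ _)
      _ ≤ Λ * (c * ‖D‖) * ‖D‖ := by
          rw [hZX, norm_neg, norm_smul, Real.norm_of_nonneg hc] at hΛ
          gcongr
      _ = Λ * c * ‖D‖ ^ 2 := by ring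
      _ ≤ 1 / 2 * ‖D‖ ^ 2 := by gcongr
  have hsplit : frobInner (gf Z) D - frobInner G D =
      frobInner (gf Z - gf X) D + ‖D‖ ^ 2 := by
    rw [← frobInner_self, ← frobInner_sub_left, ← frobInner_add_left, hD]
    congr 1
    abel
  have hGZ : frobInner G Z = frobInner G X - c * frobInner G D := by
    rw [hZ, sub_eq_add_neg, frobInner_add_right, frobInner_neg_right, frobInner_smul_right]
    ring
  rw [hZX, frobInner_neg_right, frobInner_smul_right] at hconv
  nlinarith

end IsSubgradient

/-- Gradient steps of size at most `ηmax` for the convex functions `f - ⟨gh Y, ·⟩`, `Y ∈ K`, taken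
at points of `K`, stay in the cone and achieve the sufficient decrease of gradient descent. Up to a
constant, `f - ⟨gh Y, ·⟩` is the surrogate at `Y` when `gh` is the gradient of `h`. -/
def IsStepBound (f : Mat d → ℝ) (gf gh : Mat d → Mat d) (K : Set (Mat d)) (ηmax : ℝ) : Prop :=
  ∀ X ∈ K, ∀ Y ∈ K, ∀ c : ℝ, 0 < c → c ≤ ηmax → X - c • (gf X - gh Y) ∈ PD d ∧
    f (X - c • (gf X - gh Y)) - frobInner (gh Y) (X - c • (gf X - gh Y)) ≤
      f X - frobInner (gh Y) X - c / 2 * ‖gf X - gh Y‖ ^ 2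

lemma exists_isStepBound (hf : IsSubgradient f gf) (hlip : LocallyLipschitzOn (PD d) gf)
    (hh : IsSubgradient h gh) (hcont : ContinuousOn gh (PD d)) (hA : A ∈ PD d) (B : Mat d) :
    ∃ ηmax : ℝ, 0 < ηmax ∧ IsStepBound f gf gh (Set.Icc A B) ηmax := by
  have hKP : Set.Icc A B ⊆ PD d := Icc_subset_PD hA
  have hA' : (1 / 2 : ℝ) • A ∈ PD d := smul_mem_PD hA one_half_pos
  obtain ⟨ε, hε, hmem⟩ := exists_pos_forall_add_mem_Icc hA
  obtain ⟨Cf, hCf⟩ := (isCompact_Icc_matrix A B).exists_bound_of_continuousOn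
    (hlip.continuousOn.mono hKP)
  obtain ⟨Ch, hCh⟩ := (isCompact_Icc_matrix A B).exists_bound_of_continuousOn (hcont.mono hKP)
  obtain ⟨Λ, hΛ⟩ := (hlip.mono (Icc_subset_PD hA')).exists_lipschitzOnWith_of_compact
    (isCompact_Icc_matrix _ (B + (1 / 2 : ℝ) • A))
  refine ⟨min (ε / (|Cf + Ch| + 1)) (1 / (2 * (Λ + 1))), by positivity,
    fun X hX Y hY c hc hcmax => ?_⟩
  obtain ⟨hcε, hcΛ⟩ := le_min_iff.1 hcmax
  rw [le_div_iff₀ (by positivity)] at hcε hcΛ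
  have hnorm : ‖c • (gf X - gh Y)‖ ≤ ε := by
    rw [norm_smul, Real.norm_of_nonneg hc.le]
    refine le_trans ?_ hcε
    gcongr
    linarith [norm_sub_le_of_le (hCf X hX) (hCh Y hY), le_abs_self (Cf + Ch)]
  have hsymm : (c • (gf X - gh Y)).IsSymm :=
    ((hf.isSymm X (hKP hX)).sub (hh.isSymm Y (hKP hY))).smul c
  have hZ : X - c • (gf X - gh Y) ∈ Set.Icc ((1 / 2 : ℝ) • A) (B + (1 / 2 : ℝ) • A) := by
    rw [sub_eq_add_neg]
    exact hmem B X hX _ hsymm.neg (norm_neg (c • (gf X - gh Y)) |>.trans_le hnorm)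
  have hX' : X ∈ Set.Icc ((1 / 2 : ℝ) • A) (B + (1 / 2 : ℝ) • A) := by
    simpa using hmem B X hX 0 Matrix.isSymm_zero (by simpa using hε.le)
  refine ⟨Icc_subset_PD hA' hZ, hf.gradientStep_le (Λ := Λ) (hKP hX) (Icc_subset_PD hA' hZ) hc.le
    (by nlinarith) ?_⟩
  simpa only [dist_eq_norm] using hΛ.dist_le_mul _ hZ X hX'

/-- Gradient descent with step sizes `η` on `f - ⟨gh Y, ·⟩`, started at `Y`, where `gf` is the
gradient of `f`: the inner loop of the algorithm for a general decomposition. -/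
def surrogateDescent (gf gh : Mat d → Mat d) (η : ℕ → ℝ) (Y : Mat d) : ℕ → Mat d
  | 0 => Y
  | l + 1 => surrogateDescent gf gh η Y l - η l • (gf (surrogateDescent gf gh η Y l) - gh Y)

namespace IsStepBound

lemma surrogateDescent_spec (hstep : IsStepBound f gf gh K ηmax) (hh : IsSubgradient h gh)
    (hφ : ∀ X ∈ PD d, φ X = f X - h X) (hK : sublevel φ X₀ ⊆ K)
    (hη : ∀ l, 0 < η l ∧ η l ≤ ηmax) (hY : Y ∈ sublevel φ X₀) (l : ℕ) :
    surrogateDescent gf gh η Y l ∈ sublevel φ X₀ ∧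
      f (surrogateDescent gf gh η Y l) - frobInner (gh Y) (surrogateDescent gf gh η Y l) ≤
        f Y - frobInner (gh Y) Y -
          ∑ i ∈ Finset.range l, η i / 2 * ‖gf (surrogateDescent gf gh η Y i) - gh Y‖ ^ 2 := by
  have hnonneg : ∀ i, 0 ≤ η i / 2 * ‖gf (surrogateDescent gf gh η Y i) - gh Y‖ ^ 2 := fun i =>
    mul_nonneg (half_pos (hη i).1).le (sq_nonneg _)
  induction l with
  | zero => exact ⟨hY, by simp [surrogateDescent]⟩
  | succ l ih =>
    obtain ⟨hmem, hdec⟩ := ih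
    obtain ⟨hPD, hdec'⟩ := hstep _ (hK hmem) Y (hK hY) (η l) (hη l).1 (hη l).2
    rw [← surrogateDescent] at hPD hdec'
    have hsum := hdec'.trans (sub_le_sub_right hdec _)
    rw [sub_sub, ← Finset.sum_range_succ] at hsum
    refine ⟨⟨hPD, ?_⟩, hsum⟩
    linarith [hh.sub_le_linearized_sub hφ hPD hY.1, hY.2,
      Finset.sum_nonneg fun i (_ : i ∈ Finset.range (l + 1)) => hnonneg i]

lemma le_sub_norm_sq (hstep : IsStepBound f gf gh K ηmax) (hh : IsSubgradient h gh)
    (hφ : ∀ X ∈ PD d, φ X = f X - h X) (hK : sublevel φ X₀ ⊆ K)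
    (hη : ∀ l, 0 < η l ∧ η l ≤ ηmax) (hY : Y ∈ sublevel φ X₀) {L : ℕ} (hL : 1 ≤ L) :
    φ (surrogateDescent gf gh η Y L) ≤ φ Y - η 0 / 2 * ‖gf Y - gh Y‖ ^ 2 := by
  obtain ⟨hmem, hdec⟩ := hstep.surrogateDescent_spec hh hφ hK hη hY L
  have hfirst := Finset.single_le_sum
    (f := fun i => η i / 2 * ‖gf (surrogateDescent gf gh η Y i) - gh Y‖ ^ 2)
    (fun i _ => mul_nonneg (half_pos (hη i).1).le (sq_nonneg _)) (Finset.mem_range.2 hL)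
  simp only [surrogateDescent] at hfirst
  linarith [hh.sub_le_linearized_sub hφ hmem.1 hY.1]

lemma mem_sublevel (hstep : IsStepBound f gf gh K ηmax) (hh : IsSubgradient h gh)
    (hφ : ∀ X ∈ PD d, φ X = f X - h X) (hK : sublevel φ X₀ ⊆ K) (hX₀ : X₀ ∈ PD d)
    (hη : ∀ l, 0 < η l ∧ η l ≤ ηmax) {L : ℕ} (hx₀ : x 0 = X₀)
    (hx : ∀ k, x (k + 1) = surrogateDescent gf gh η (x k) L) (k : ℕ) : x k ∈ sublevel φ X₀ := by
  induction k with
  | zero =>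
    rw [hx₀]
    exact ⟨hX₀, le_rfl⟩
  | succ k ih =>
    rw [hx]
    exact (hstep.surrogateDescent_spec hh hφ hK hη ih L).1

end IsStepBound

lemma tendsto_zero_of_le_sub_mul_sq {u v : ℕ → ℝ} {c m : ℝ} (hc : 0 < c) (hm : ∀ k, m ≤ u k)
    (hu : ∀ k, u (k + 1) ≤ u k - c * v k ^ 2) : Tendsto v atTop (𝓝 0) := by
  have hanti : Antitone u := antitone_nat_of_succ_le fun k =>
    (hu k).trans (sub_le_self _ (mul_nonneg hc.le (sq_nonneg _)))
  have hlim := tendsto_atTop_ciInf hanti ⟨m, Set.forall_mem_range.2 hm⟩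
  have hdiff : Tendsto (fun k => (u k - u (k + 1)) / c) atTop (𝓝 0) := by
    simpa using (hlim.sub (hlim.comp (tendsto_add_atTop_nat 1))).div_const c
  have hsq : Tendsto (fun k => v k ^ 2) atTop (𝓝 0) :=
    squeeze_zero (fun k => sq_nonneg _) (fun k => by
      rw [le_div_iff₀ hc]
      linarith [hu k]) hdiff
  refine (tendsto_zero_iff_abs_tendsto_zero v).2 ?_
  simpa [Function.comp_def, Real.sqrt_sq_eq_abs] using hsq.sqrt

lemma tendsto_surrogateDescent (hfcont : ContinuousOn gf (PD d)) (hhcont : ContinuousOn gh (PD d))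
    (hXs : Xs ∈ PD d) (hcrit : gf Xs = gh Xs)
    (hmem : ∀ l k, surrogateDescent gf gh η (x k) l ∈ PD d) (hx : Tendsto x atTop (𝓝 Xs)) (l : ℕ) :
    Tendsto (fun k => surrogateDescent gf gh η (x k) l) atTop (𝓝 Xs) := by
  have hcomp : ∀ {g : Mat d → Mat d} {y : ℕ → Mat d}, ContinuousOn g (PD d) →
      (∀ k, y k ∈ PD d) → Tendsto y atTop (𝓝 Xs) →
      Tendsto (fun k => g (y k)) atTop (𝓝 (g Xs)) := fun hg hy hlim =>
    (hg Xs hXs).tendsto.comp (tendsto_nhdsWithin_iff.2 ⟨hlim, Eventually.of_forall hy⟩)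
  induction l with
  | zero => exact hx
  | succ l ih =>
    have hstep := ih.sub (((hcomp hfcont (hmem l) ih).sub
      (hcomp hhcont (hmem 0) hx)).const_smul (η l))
    rwa [hcrit, sub_self, smul_zero, sub_zero] at hstep

theorem exists_forall_tendsto_surrogateDescent (hg : GConvex φ) (hf : IsSubgradient f gf)
    (hlip : LocallyLipschitzOn (PD d) gf) (hh : IsSubgradient h gh) (hcont : ContinuousOn gh (PD d))
    (hφ : ∀ X ∈ PD d, φ X = f X - h X) (hX₀ : X₀ ∈ PD d) (hA : A ∈ PD d)
    (hsub : sublevel φ X₀ ⊆ Set.Icc A B) (hXs : IsMinimizer φ Xs)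
    (huniq : ∀ Y, IsMinimizer φ Y → Y = Xs) :
    ∃ ηmax : ℝ, 0 < ηmax ∧ ∀ (L : ℕ) (η : ℕ → ℝ) (x : ℕ → Mat d), 1 ≤ L →
      (∀ l, 0 < η l ∧ η l ≤ ηmax) → x 0 = X₀ →
      (∀ k, x (k + 1) = surrogateDescent gf gh η (x k) L) →
      ∀ l, (∀ k, surrogateDescent gf gh η (x k) l ∈ PD d) ∧
        Tendsto (fun k => surrogateDescent gf gh η (x k) l) atTop (𝓝 Xs) := by
  have hφcont : ContinuousOn φ (PD d) := ((continuousOn_of_convexOn_PD hf.convexOn).sub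
    (continuousOn_of_convexOn_PD hh.convexOn)).congr hφ
  have hS := isCompact_sublevel hφcont hA hsub
  have hSP : sublevel φ X₀ ⊆ PD d := fun X hX => hX.1
  obtain ⟨R, hR⟩ := exists_riemDist_le_of_isCompact hS hSP hXs.1
  obtain ⟨ηmax, hηmax, hstep⟩ := exists_isStepBound hf hlip hh hcont hA B
  refine ⟨ηmax, hηmax, fun L η x hL hη hx₀ hx => ?_⟩
  have hmem := hstep.mem_sublevel hh hφ hsub hX₀ hη hx₀ hx
  have hresidual : Tendsto (fun k => ‖gf (x k) - gh (x k)‖) atTop (𝓝 0) :=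
    tendsto_zero_of_le_sub_mul_sq (u := φ ∘ x) (half_pos (hη 0).1)
      (fun k => hXs.2 _ (hmem k).1) fun k => by
        rw [Function.comp_apply, hx]
        exact hstep.le_sub_norm_sq hh hφ hsub hη (hmem k) hL
  have hvalue : Tendsto (fun k => φ (x k)) atTop (𝓝 (φ Xs)) := by
    refine tendsto_sub_nhds_zero_iff.1 (squeeze_zero (fun k => sub_nonneg.2 (hXs.2 _ (hmem k).1))
      (fun k => sub_le_norm_subgradient_sub_mul hg hf hh hcont hφ (hmem k).1 hXs.1
        (hR _ (hmem k))) ?_)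
    simpa using hresidual.mul_const (speedBound Xs R)
  have hlim : Tendsto x atTop (𝓝 Xs) := hXs.tendsto_of_unique hφcont huniq hS hSP hmem hvalue
  have hcrit : gf Xs = gh Xs := by
    have hlimPD := tendsto_nhdsWithin_iff.2 ⟨hlim, Eventually.of_forall fun k => (hmem k).1⟩
    have hlimnorm := (((hlip.continuousOn Xs hXs.1).sub (hcont Xs hXs.1)).norm.tendsto).comp hlimPD
    exact sub_eq_zero.1 (norm_eq_zero.1 (tendsto_nhds_unique hlimnorm hresidual))
  have hinner (l k : ℕ) : surrogateDescent gf gh η (x k) l ∈ PD d :=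
    (hstep.surrogateDescent_spec hh hφ hsub hη (hmem k) l).1.1
  exact fun l =>
    ⟨hinner l, tendsto_surrogateDescent hlip.continuousOn hcont hXs.1 hcrit hinner hlim l⟩

end SurrogateDescent

section OptimisticLikelihood

variable {d : ℕ} {S T X₀ Xs : Mat d} {β : ℝ}

lemma innerIter_eq_surrogateDescent (S T : Mat d) (β : ℝ) (η : ℕ → ℝ) (Y : Mat d) (l : ℕ) :
    innerIter S T β η Y l =
      surrogateDescent (optLikGradF S β) (optLikGradH T β) η Y l := by
  induction l with
  | zero => rfl
  | succ l ih =>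
    rw [innerIter, surrogateDescent, ih, optLikGradF, optLikGradH]
    congr 2
    abel

theorem optLik_convergence (hS : S.PosSemidef) (hT : T ∈ PD d) (hX₀ : X₀ ∈ PD d) (hβ : 0 < β)
    (hor : S.PosDef ∨ 2 < β) :
    ∃ Xs, IsMinimizer (optLik S T β) Xs ∧
      (∀ Y, IsMinimizer (optLik S T β) Y → Y = Xs) ∧
      (∃ X, IsCCCP (optLikF S T β) (optLikH T β) X₀ X) ∧
      (∀ X : ℕ → Mat d, IsCCCP (optLikF S T β) (optLikH T β) X₀ X →
        Tendsto X atTop (𝓝 Xs) ∧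
        ∃ C : ℝ, ∀ k : ℕ, 1 ≤ k → optLik S T β (X k) - optLik S T β Xs ≤ C / (k + 2)) ∧
      (∃ ηmax : ℝ, 0 < ηmax ∧ ∀ (L : ℕ) (η : ℕ → ℝ), 1 ≤ L → (∀ l, 0 < η l ∧ η l ≤ ηmax) →
        ∀ l ≤ L, (∀ k, innerIter S T β η (outerIter S T β η L X₀ k) l ∈ PD d) ∧
          Tendsto (fun k => innerIter S T β η (outerIter S T β η L X₀ k) l) atTop (𝓝 Xs)) := by
  have hdc := isDC_optLik hS hT hβ.le
  have hg := gConvex_optLik hS hT hβ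
  obtain ⟨A, hA, B, hAB⟩ := exists_Icc_of_optLik_le hS hT hβ hor (optLik S T β X₀)
  have hsub : sublevel (optLik S T β) X₀ ⊆ Set.Icc A B := fun X hX => hAB X hX.1 hX.2
  have hcpt := isCompact_sublevel hdc.continuousOn hA hsub
  have hSP : sublevel (optLik S T β) X₀ ⊆ PD d := fun X hX => hX.1
  obtain ⟨⟨Xs, hXs⟩, hex, ⟨L, hL0, hL⟩, -⟩ :=
    cccp_convergence hg hdc hX₀ (exists_riemDist_le_of_isCompact hcpt hSP hX₀)
  have huniq : ∀ Y, IsMinimizer (optLik S T β) Y → Y = Xs := fun Y hY =>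
    hY.eq_of_optLik hXs hS hT hβ
  obtain ⟨R, hR⟩ := exists_riemDist_le_of_isCompact hcpt hSP hXs.1
  obtain ⟨ηmax, hηmax, hdescent⟩ := exists_forall_tendsto_surrogateDescent hg
    (isSubgradient_optLikF hS hT hβ.le) (locallyLipschitzOn_optLikGradF S β)
    (isSubgradient_optLikH hT hβ.le) (locallyLipschitzOn_optLikGradH hT β).continuousOn hdc.eq_sub
    hX₀ hA hsub hXs huniq
  refine ⟨Xs, hXs, huniq, hex, fun X hX => ⟨?_, _, fun k hk =>
    hX.sub_le_div hg hdc hX₀ hXs hR hL0 hL hk⟩, ηmax, hηmax, fun L η hL hη l _ => ?_⟩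
  · exact hXs.tendsto_of_unique hdc.continuousOn huniq hcpt hSP (hX.mem_sublevel hdc hX₀)
      (hX.tendsto hg hdc hX₀ hXs hR hL0 hL)
  · simp only [innerIter_eq_surrogateDescent]
    exact hdescent L η _ hL hη rfl (fun k => innerIter_eq_surrogateDescent ..) l

end OptimisticLikelihood

end SPDCone

end

open SPDCone Filter Topology in
theorem mainTheorem8 (d : ℕ) :
    -- convergence of the convex-concave procedure for g-convex DC regularized objectives
    (∃ α : Mat d → ℝ → ℝ, ∀ (φ Reg f h : Mat d → ℝ) (X₀ : Mat d),
      GConvex (regularized φ Reg) → IsDC (regularized φ Reg) f h → X₀ ∈ PD d →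
      (∃ B : ℝ, ∀ Y ∈ sublevel (regularized φ Reg) X₀, riemDist Y X₀ ≤ B) →
      (∃ Xs, IsMinimizer (regularized φ Reg) Xs) ∧
      (∃ X, IsCCCP f h X₀ X) ∧
      (∃ L : ℝ, 0 ≤ L ∧
        LipschitzGradOn h L (convexHull ℝ (sublevel (regularized φ Reg) X₀))) ∧
      ∀ X : ℕ → Mat d, IsCCCP f h X₀ X →
        (∀ (Xs : Mat d) (R L : ℝ), IsMinimizer (regularized φ Reg) Xs →
          (∀ Y ∈ sublevel (regularized φ Reg) X₀, riemDist Y Xs ≤ R) → 0 ≤ L →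
          LipschitzGradOn h L (convexHull ℝ (sublevel (regularized φ Reg) X₀)) →
          ∀ k : ℕ, 1 ≤ k →
            regularized φ Reg (X k) - regularized φ Reg Xs ≤ 2 * L * α Xs R ^ 2 / (k + 2)) ∧
        (∀ ε : ℝ, 0 < ε → ∀ᶠ k in atTop, ∃ Y, IsMinimizer (regularized φ Reg) Y ∧
          riemDist (X k) Y < ε)) ∧
    -- the S-divergence regularized Gaussian optimistic likelihood
    (∀ (S T X₀ : Mat d) (β : ℝ), S.PosSemidef → T ∈ PD d → X₀ ∈ PD d → 0 < β →
      (S.PosDef ∨ 2 < β) →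
      ∃ Xs, IsMinimizer (optLik S T β) Xs ∧
        (∀ Y, IsMinimizer (optLik S T β) Y → Y = Xs) ∧
        -- exact convex-concave procedure
        (∃ X, IsCCCP (optLikF S T β) (optLikH T β) X₀ X) ∧
        (∀ X : ℕ → Mat d, IsCCCP (optLikF S T β) (optLikH T β) X₀ X →
          Tendsto X atTop (𝓝 Xs) ∧
          ∃ C : ℝ, ∀ k : ℕ, 1 ≤ k →
            optLik S T β (X k) - optLik S T β Xs ≤ C / (k + 2)) ∧
        -- with the surrogate minimized by `L` gradient steps
        (∃ ηmax : ℝ, 0 < ηmax ∧ ∀ (L : ℕ) (η : ℕ → ℝ), 1 ≤ L → (∀ l, 0 < η l ∧ η l ≤ ηmax) →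
          ∀ l ≤ L,
            (∀ k, innerIter S T β η (outerIter S T β η L X₀ k) l ∈ PD d) ∧
            Tendsto (fun k => innerIter S T β η (outerIter S T β η L X₀ k) l)
              atTop (𝓝 Xs))) := by
  exact ⟨⟨fun Xs R => Real.sqrt 2 * speedBound Xs R, fun _ _ _ _ _ hg hdc hX₀ hbdd =>
    cccp_convergence hg hdc hX₀ hbdd⟩, fun _ _ _ _ hS hT hX₀ hβ hor =>
    optLik_convergence hS hT hX₀ hβ hor⟩
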